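/- Let $\lambda\in(0,\infty)$, $\beta\in(1,\infty)$, and let $\alpha$ be a random variable with values in $(0,1)$ having a probability density of the form $\psi(x)(1-x)^\beta$, $x\in(0,1)$, where $\psi:(0,1)\to[0,\infty)$ is measurable and $\lim_{x\uparrow1}\psi(x)=\psi_1\in(0,\infty)$. Let $X_0$, $\xi_{k,i}$, $\varepsilon_k$ $(k,i\ge1)$ be random variables that are conditionally independent given $\alpha$, such that, given $\alpha$, each $\xi_{k,i}$ is Bernoulli distributed with $P(\xi_{k,i}=1\mid\alpha)=\alpha=1-P(\xi_{k,i}=0\mid\alpha)$, each $\varepsilon_k$ is Poisson distributed with mean $\lambda$, and $X_0$ is Poisson distributed with mean $\lambda/(1-\alpha)$; and set $$X_k=\sum_{i=1}^{X_{k-1}}\xi_{k,i}+\varepsilon_k,\qquad k\ge1 .$$ Let $(\alpha^{(j)},(X^{(j)}_k)_{k\ge0})$, $j\ge1$, be independent copies of $(\alpha,(X_k)_{k\ge0})$, constructed in this way from independent copies of $(\alpha,X_0,(\xi_{k,i}),(\varepsilon_k))$, and for $N,n\ge1$ put $$\widetilde S^{(N,n)}_t=\sum_{j=1}^N\sum_{k=1}^{\lfloor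 nt\rfloor}\bigl(X^{(j)}_k-E(X^{(j)}_k\mid\alpha^{(j)})\bigr),\qquad t\ge0 .$$ Let $\mathcal D_f\text{-}\lim$ denote the limit in the sense of weak convergence of finite-dimensional distributions; an iterated limit $\mathcal D_f\text{-}\lim_{p\to\infty}\mathcal D_f\text{-}\lim_{q\to\infty}Z^{(p,q)}=W$ means that for each $p\ge1$ the processes $Z^{(p,q)}$ converge as $q\to\infty$ to some process $Z^{(p)}$, and that $Z^{(p)}$ converges to $W$ as $p\to\infty$. Then $E\bigl((1+\alpha)(1-\alpha)^{-2}\bigr)<\infty$, both of the following iterated limits exist, and $$\mathcal D_f\text{-}\lim_{n\to\infty}\,\mathcal D_f\text{-}\lim_{N\to\infty}\,(nN)^{-1/2}\,\widetilde S^{(N,n)}=\mathcal D_f\text{-}\lim_{N\to\infty}\,\mathcal D_f\text{-}\lim_{n\to\infty}\,(nN)^{-1/2}\,\widetilde S^{(N,n)}=\sigma B,$$ where $\sigma=\sqrt{\lambda\,E\bigl((1+\alpha)(1-\alpha)^{-2}\bigr)}$ and $B=(B_t)_{t\ge0}$ is a standard Wiener process. -/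

import Mathlib

open MeasureTheory ProbabilityTheory Filter Topology
open scoped NNReal ENNReal Nat

noncomputable section

/-- Index set of the primitive random variables of one randomized INAR(1) process: the initial
value `X₀`, the immigration (innovation) variables and the offspring variables. The immigration
and offspring variables with index `k` are the ones that produce generation `k + 1`, and the
individuals of a generation are numbered from `0`. -/
inductive NoiseIndex : Type
  | initial : NoiseIndex
  | immigration (k : ℕ) : NoiseIndex
  | offspring (k i : ℕ) : NoiseIndex

/-- The family `(Y i)` is conditionally independent given the sub-σ-algebra `m`: for finitely many
indices and measurable sets, the conditional probability of the intersection is almost surely the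
product of the conditional probabilities. (This is the characterization
`ProbabilityTheory.iCondIndepFun_iff_condExp_inter_preimage_eq_mul`; taken as the definition it
makes sense on every probability space, not only on standard Borel ones.) -/
def CondIndepFamily {Ω ι E : Type*} [MeasurableSpace E] (m : MeasurableSpace Ω)
    {mΩ : MeasurableSpace Ω} (Y : ι → Ω → E) (μ : @Measure Ω mΩ) : Prop :=
  ∀ (s : Finset ι) (A : ι → Set E), (∀ i ∈ s, MeasurableSet (A i)) →
    μ⟦⋂ i ∈ s, Y i ⁻¹' A i | m⟧ =ᵐ[μ] ∏ i ∈ s, μ⟦Y i ⁻¹' A i | m⟧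

/-- The σ-algebra generated by a real random variable. -/
abbrev sigmaOf {Ω : Type*} (a : Ω → ℝ) : MeasurableSpace Ω :=
  MeasurableSpace.comap a inferInstance

/-- `Y` is a system of primitive variables of a randomized INAR(1) process with random thinning
parameter `a` and Poisson innovations with parameter `lam`: given `a`, the variables are
independent, the offspring are Bernoulli with success probability `a`, the innovations are Poisson
with mean `lam`, and the initial value is Poisson with mean `lam / (1 - a)`. -/
structure IsRandomizedINARNoise {Ω : Type*} {mΩ : MeasurableSpace Ω} (μ : Measure Ω) (lam : ℝ)
    (a : Ω → ℝ) (Y : NoiseIndex → Ω → ℕ) : Prop where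
  measurable_param : Measurable a
  measurable_noise : ∀ i, Measurable (Y i)
  condIndep : CondIndepFamily (sigmaOf a) Y μ
  offspring_one : ∀ k i,
    μ⟦Y (NoiseIndex.offspring k i) ⁻¹' {1} | sigmaOf a⟧ =ᵐ[μ] fun ω => a ω
  offspring_zero : ∀ k i,
    μ⟦Y (NoiseIndex.offspring k i) ⁻¹' {0} | sigmaOf a⟧ =ᵐ[μ] fun ω => 1 - a ω
  immigration : ∀ k l : ℕ,
    μ⟦Y (NoiseIndex.immigration k) ⁻¹' {l} | sigmaOf a⟧ =ᵐ[μ]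
      fun _ => lam ^ l / (l ! : ℝ) * Real.exp (-lam)
  initial : ∀ l : ℕ,
    μ⟦Y NoiseIndex.initial ⁻¹' {l} | sigmaOf a⟧ =ᵐ[μ]
      fun ω => (lam / (1 - a ω)) ^ l / (l ! : ℝ) * Real.exp (-(lam / (1 - a ω)))

/-- The Galton–Watson process with immigration driven by the primitive variables `Y`:
`X₀ = Y initial`, and generation `k + 1` consists of the offspring of the `X_k` individuals of
generation `k` together with the immigrants. -/
def inarProcess {Ω : Type*} (Y : NoiseIndex → Ω → ℕ) : ℕ → Ω → ℕ
  | 0 => Y NoiseIndex.initial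
  | k + 1 => fun ω =>
      (∑ i ∈ Finset.range (inarProcess Y k ω), Y (NoiseIndex.offspring k i) ω)
        + Y (NoiseIndex.immigration k) ω

/-- The aggregated, conditionally centred process
`S̃_t^{(N,n)} = ∑_{j=1}^N ∑_{k=1}^{⌊nt⌋} (X_k^{(j)} - E(X_k^{(j)} | α^{(j)}))`.
The copies `j = 1, …, N` are numbered `0, …, N - 1`. -/
def aggregated {Ω : Type*} {mΩ : MeasurableSpace Ω} (μ : Measure Ω) (α : ℕ → Ω → ℝ)
    (X : ℕ → ℕ → Ω → ℕ) (N n : ℕ) (t : ℝ≥0) (ω : Ω) : ℝ :=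
  ∑ j ∈ Finset.range N, ∑ k ∈ Finset.Icc 1 ⌊(n : ℝ) * t⌋₊,
    ((X j k ω : ℝ) - (μ[fun ω' => (X j k ω' : ℝ) | sigmaOf (α j)]) ω)

/-- Weak convergence of the finite-dimensional distributions of the real processes `Z i`
(each on its own probability space) to those of `W`, along the filter `l`. -/
def TendstoFDD {ι T Ω' : Type*} {Ω : ι → Type*} {mΩ : ∀ i, MeasurableSpace (Ω i)}
    {mΩ' : MeasurableSpace Ω'} (Z : (i : ι) → T → Ω i → ℝ) (l : Filter ι) (W : T → Ω' → ℝ)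
    (μ : (i : ι) → Measure (Ω i)) [∀ i, IsProbabilityMeasure (μ i)]
    (ν : Measure Ω') [IsProbabilityMeasure ν] : Prop :=
  ∀ I : Finset T, TendstoInDistribution (fun i ω => I.restrict (Z i · ω)) l
    (fun ω => I.restrict (W · ω)) μ ν

/-- The iterated limit `lim_{p → ∞} lim_{q → ∞} Z p q`, in the sense of finite-dimensional
distributions, exists and equals `W`: for every `p ≥ 1` the processes `Z p q` converge as `q → ∞`
to some process, and these limits converge to `W` as `p → ∞`. The intermediate limit process for
`p` is realized as the coordinate process under a probability measure `P p` on path space. -/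
def IsIteratedFDDLimit {Ω Ω' : Type*} {mΩ : MeasurableSpace Ω} {mΩ' : MeasurableSpace Ω'}
    (Z : ℕ → ℕ → ℝ≥0 → Ω → ℝ) (W : ℝ≥0 → Ω' → ℝ) (μ : Measure Ω) [IsProbabilityMeasure μ]
    (ν : Measure Ω') [IsProbabilityMeasure ν] : Prop :=
  ∃ P : ℕ → ProbabilityMeasure (ℝ≥0 → ℝ),
    (∀ p : ℕ, 1 ≤ p →
      TendstoFDD (fun q => Z p q) atTop (fun t (x : ℝ≥0 → ℝ) => x t) (fun _ => μ)
        (P p : Measure (ℝ≥0 → ℝ))) ∧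
    TendstoFDD (fun (_ : ℕ) t (x : ℝ≥0 → ℝ) => x t) atTop W
      (fun p => (P p : Measure (ℝ≥0 → ℝ))) ν

end

/-! By Lévy's continuity theorem everything reduces to characteristic functions of linear
combinations of the values at finitely many times (`tendstoFDD_of_tendsto_charFun`). These can be
computed almost explicitly. Given `α = a`, the branching step sends `w ^ X_{k+1}` to `(1 - a + a w)
^ X_k * exp (lam (w - 1))`, and the initial value is Poisson, so the joint generating function is
the exponential of a finite recursion, `inarLogPgf`. After centring by `E(X_k | α) = lam / (1 - α)`,
the independence and common law of the copies turn the characteristic function of the aggregate into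
`(E exp (inarLogChar lam α θ m)) ^ N` (`integral_exp_aggregated`).

The quadratic part of `inarLogChar` is minus half the conditional variance `lam / (1 - a) * ∑ a ^ |k
- l| θ_k θ_l`. If `N → ∞` first, `N (E exp (inarLogChar) - 1)` tends to minus half the expected
variance; the limit is the partial sum process of a Gaussian sequence with the averaged covariances.
As `n → ∞`, the double sums of `a ^ |k - l|` divided by `n` approach `(1 + a) / (1 - a)` times the
Wiener covariance. If `n → ∞` first, each copy satisfies a central limit theorem with conditional
variance `lam (1 + a) / (1 - a) ^ 2`, so the limit is a Wiener process with an independent random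
variance, the average over the `N` copies; as `N → ∞` this average concentrates at its mean, which
is seen on powers of Laplace transforms.

The analytic point is to exchange limits with the expectation over `α`, whose density may be
concentrated near 1. The condition `β > 1` gives exactly `E (1 - α)⁻² < ∞`, so dominating functions
may contain at most two powers of `1 / (1 - α)`. Hence there are two expansions: a crude first-order
one with a single power, used for domination, and a sharp second-order one with four powers, used
only for fixed `a`. -/

/-! ### The logarithm of the generating function of the Poisson INAR(1) process -/

/-- The logarithm of the joint generating function of the stationary Poisson INAR(1) process with
thinning parameter `a`: the value at `m`, `w` corresponds to `E (∏_{k < m} z_k ^ X_k) w ^ X_m`. -/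
noncomputable def inarLogPgf (lam a : ℝ) (z : ℕ → ℂ) : ℕ → ℂ → ℂ
  | 0, w => (lam / (1 - a) : ℝ) * (w - 1)
  | m + 1, w => lam * (w - 1) + inarLogPgf lam a z m (z m * (1 - a + a * w))

/-- The quadratic form `∑_{k, l < m} a ^ |k - l| θ_k θ_l`. -/
noncomputable def geomQuadForm (a : ℝ) (θ : ℕ → ℝ) (m : ℕ) : ℝ :=
  ∑ k ∈ Finset.range m, ∑ l ∈ Finset.range m, a ^ (Nat.dist k l) * (θ k * θ l)

/-- The geometrically weighted partial sums `∑_{k < m} a ^ (m - 1 - k) θ_k`. -/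
noncomputable def geomWeightedSum (a : ℝ) (θ : ℕ → ℝ) : ℕ → ℝ
  | 0 => 0
  | m + 1 => θ m + a * geomWeightedSum a θ m

/-- The logarithm of the conditional characteristic function of the conditionally centred
process. -/
noncomputable def inarLogChar (lam a : ℝ) (θ : ℕ → ℝ) (m : ℕ) : ℂ :=
  inarLogPgf lam a (fun k => Complex.exp (Complex.I * θ k)) m 1
    - Complex.I * ((lam / (1 - a) * ∑ k ∈ Finset.range m, θ k : ℝ) : ℂ)

theorem sum_geom_dist (a : ℝ) (θ : ℕ → ℝ) (m : ℕ) :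
    ∑ k ∈ Finset.range m, a ^ (Nat.dist k m) * θ k = a * geomWeightedSum a θ m := by
  induction m with
  | zero => simp [geomWeightedSum]
  | succ m ih =>
    rw [Finset.sum_range_succ, geomWeightedSum, ← ih, mul_add, Finset.mul_sum, add_comm]
    congr 1
    · simp [Nat.dist]
    · refine Finset.sum_congr rfl fun k hk => ?_
      have hk := Finset.mem_range.1 hk
      have : Nat.dist k (m + 1) = Nat.dist k m + 1 := by simp only [Nat.dist]; omega
      rw [this]; ring

/-- The new row and the new column contribute equally. This one-step form is what matches the
recursion of the generating function in the second-order expansion. -/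
theorem geomQuadForm_succ (a : ℝ) (θ : ℕ → ℝ) (m : ℕ) :
    geomQuadForm a θ (m + 1) =
      geomQuadForm a θ m + θ m ^ 2 + 2 * a * θ m * geomWeightedSum a θ m := by
  have h1 : ∑ k ∈ Finset.range m, a ^ (Nat.dist k m) * (θ k * θ m)
      = θ m * (a * geomWeightedSum a θ m) := by
    rw [← sum_geom_dist, Finset.mul_sum]
    exact Finset.sum_congr rfl fun k _ => by ring
  have h2 : ∑ k ∈ Finset.range m, a ^ (Nat.dist m k) * (θ m * θ k)
      = θ m * (a * geomWeightedSum a θ m) := by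
    rw [← h1]
    exact Finset.sum_congr rfl fun k _ => by rw [Nat.dist_comm]; ring
  unfold geomQuadForm
  simp only [Finset.sum_range_succ, Finset.sum_add_distrib, h1, h2, Nat.dist_self, pow_zero]
  ring

theorem geomQuadForm_const_mul (a c : ℝ) (θ : ℕ → ℝ) (m : ℕ) :
    geomQuadForm a (fun k => c * θ k) m = c ^ 2 * geomQuadForm a θ m := by
  unfold geomQuadForm
  simp only [Finset.mul_sum]
  exact Finset.sum_congr rfl fun _ _ => Finset.sum_congr rfl fun _ _ => by ring

theorem norm_thinning_le_one {a : ℝ} (ha0 : 0 < a) (ha1 : a < 1) {z w : ℂ} (hz : ‖z‖ ≤ 1)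
    (hw : ‖w‖ ≤ 1) : ‖z * (1 - a + a * w)‖ ≤ 1 := by
  have h1 : ‖(1 - a + a * w : ℂ)‖ ≤ 1 := by
    calc ‖(1 - a + a * w : ℂ)‖ ≤ ‖((1 - a : ℝ) : ℂ)‖ + ‖(a : ℂ) * w‖ := by
          push_cast; exact norm_add_le _ _
      _ ≤ (1 - a) + a * 1 := by
          rw [norm_mul, Complex.norm_real, Complex.norm_real, Real.norm_of_nonneg (by linarith),
            Real.norm_of_nonneg ha0.le]
          gcongr
      _ = 1 := by ring
  rw [norm_mul]
  exact mul_le_one₀ hz (norm_nonneg _) h1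

/-- The map `w ↦ z (1 - a + a w)` preserves the closed unit disc, where every summand `c (w - 1)`
with `c ≥ 0` has nonpositive real part. -/
theorem re_inarLogPgf_nonpos {lam a : ℝ} (hlam : 0 < lam) (ha0 : 0 < a) (ha1 : a < 1)
    {z : ℕ → ℂ} (hz : ∀ k, ‖z k‖ ≤ 1) (m : ℕ) :
    ∀ {w : ℂ}, ‖w‖ ≤ 1 → (inarLogPgf lam a z m w).re ≤ 0 := by
  have key : ∀ (c : ℝ), 0 ≤ c → ∀ w : ℂ, ‖w‖ ≤ 1 → ((c : ℂ) * (w - 1)).re ≤ 0 := by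
    intro c hc w hw
    have := (Complex.re_le_norm w).trans hw
    simp only [Complex.mul_re, Complex.ofReal_re, Complex.sub_re, Complex.one_re,
      Complex.ofReal_im, zero_mul, sub_zero]
    nlinarith
  induction m with
  | zero =>
    intro w hw
    exact key _ (div_nonneg hlam.le (by linarith)) w hw
  | succ m ih =>
    intro w hw
    have h1 := key lam hlam.le w hw
    have h2 := ih (norm_thinning_le_one ha0 ha1 (hz m) hw)
    simp only [inarLogPgf, Complex.add_re]
    linarith

theorem norm_exp_inarLogChar_le {lam a : ℝ} (hlam : 0 < lam) (ha0 : 0 < a) (ha1 : a < 1)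
    (θ : ℕ → ℝ) (m : ℕ) : ‖Complex.exp (inarLogChar lam a θ m)‖ ≤ 1 := by
  rw [Complex.norm_exp, Real.exp_le_one_iff, inarLogChar, Complex.sub_re]
  have h := re_inarLogPgf_nonpos (z := fun k => Complex.exp (Complex.I * θ k)) hlam ha0 ha1
    (fun k => by rw [mul_comm, Complex.norm_exp_ofReal_mul_I]) m (w := 1) (by simp)
  rw [Complex.I_mul_re, Complex.ofReal_im]
  simpa using h

theorem norm_exp_I_sub_le {θ ε : ℝ} (hθ : |θ| ≤ ε) (hε : ε ≤ 1) :
    ‖Complex.exp (Complex.I * θ) - 1‖ ≤ ε ∧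
    ‖Complex.exp (Complex.I * θ) - 1 - Complex.I * θ‖ ≤ ε ^ 2 ∧
    ‖Complex.exp (Complex.I * θ) - 1 - Complex.I * θ + (θ : ℂ) ^ 2 / 2‖ ≤ ε ^ 3 := by
  have hn : ‖Complex.I * (θ : ℂ)‖ = |θ| := by simp
  have hn1 : ‖Complex.I * (θ : ℂ)‖ ≤ 1 := by rw [hn]; linarith
  refine ⟨?_, ?_, ?_⟩
  · exact (Real.norm_exp_I_mul_ofReal_sub_one_le (x := θ)).trans hθ
  · refine (Complex.norm_exp_sub_one_sub_id_le hn1).trans ?_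
    rw [hn]; gcongr
  · have h := Complex.exp_bound hn1 (n := 3) (by norm_num)
    have h2 : (∑ m ∈ Finset.range 3, (Complex.I * (θ : ℂ)) ^ m / (m ! : ℂ))
        = 1 + Complex.I * θ - (θ : ℂ) ^ 2 / 2 := by
      simp [Finset.sum_range_succ, mul_pow, Nat.factorial]; ring
    rw [h2, hn] at h
    have h3 : Complex.exp (Complex.I * θ) - 1 - Complex.I * θ + (θ : ℂ) ^ 2 / 2
        = Complex.exp (Complex.I * θ) - (1 + Complex.I * θ - (θ : ℂ) ^ 2 / 2) := by ring
    rw [h3]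
    refine h.trans ?_
    have h4 : |θ| ^ 3 ≤ ε ^ 3 := by gcongr
    have h5 : (0 : ℝ) ≤ |θ| ^ 3 := by positivity
    norm_num [Nat.factorial]
    linarith

/-- First order expansion of the logarithm of the generating function, with constants that depend
on the time horizon. -/
theorem norm_inarLogPgf_sub_first_order_le {lam a ε : ℝ} (hlam : 0 < lam) (ha0 : 0 < a)
    (ha1 : a < 1) (hε : ε ≤ 1) {θ : ℕ → ℝ} (hθ : ∀ k, |θ k| ≤ ε) (m : ℕ) :
    ∀ (j : ℕ) (w : ℂ) (A : ℝ), |A| ≤ j * ε → ‖w - 1 - Complex.I * A‖ ≤ j ^ 2 * ε ^ 2 →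
      ‖inarLogPgf lam a (fun k => Complex.exp (Complex.I * θ k)) m w
        - Complex.I * ((lam / (1 - a) * (∑ k ∈ Finset.range m, θ k + A) : ℝ) : ℂ)‖
        ≤ lam * (m + 1 / (1 - a)) * ((j + m) ^ 2 * ε ^ 2) := by
  have h1a : 0 < 1 - a := by linarith
  have h1c : (1 - a : ℂ) ≠ 0 := by exact_mod_cast h1a.ne'
  have hε0 : 0 ≤ ε := (abs_nonneg _).trans (hθ 0)
  -- The invariant is `w = 1 + iA + O(j²ε²)`, where `j` counts the steps already made; one step
  -- replaces `A` by `θ m + a A`. Estimating `a` by 1 instead of summing a geometric series keeps `1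
  -- / (1 - a)` to the first power.
  induction m with
  | zero =>
    intro j w A hA hw
    have : inarLogPgf lam a (fun k => Complex.exp (Complex.I * θ k)) 0 w
        - Complex.I * ((lam / (1 - a) * (∑ k ∈ Finset.range 0, θ k + A) : ℝ) : ℂ)
        = ((lam / (1 - a) : ℝ) : ℂ) * (w - 1 - Complex.I * A) := by
      simp [inarLogPgf]; ring
    rw [this, norm_mul, Complex.norm_real, Real.norm_of_nonneg (by positivity)]
    calc lam / (1 - a) * ‖w - 1 - Complex.I * A‖ ≤ lam / (1 - a) * (j ^ 2 * ε ^ 2) := by gcongr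
      _ = _ := by push_cast; ring
  | succ m ih =>
    intro j w A hA hw
    obtain ⟨hz1, hz2, -⟩ := norm_exp_I_sub_le (hθ m) hε
    set z := Complex.exp (Complex.I * θ m) with hz
    have hzn : ‖z‖ = 1 := by rw [hz, mul_comm, Complex.norm_exp_ofReal_mul_I]
    have hA' : |θ m + a * A| ≤ (j + 1 : ℕ) * ε := by
      calc |θ m + a * A| ≤ |θ m| + |a * A| := abs_add_le _ _
        _ ≤ ε + 1 * (j * ε) := by
          rw [abs_mul, abs_of_pos ha0]
          gcongr
          exact hθ m
        _ = _ := by push_cast; ring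
    have hw' : ‖z * (1 - a + a * w) - 1 - Complex.I * ((θ m + a * A : ℝ) : ℂ)‖
        ≤ (j + 1 : ℕ) ^ 2 * ε ^ 2 := by
      have e : z * (1 - a + a * w) - 1 - Complex.I * ((θ m + a * A : ℝ) : ℂ)
          = (z - 1 - Complex.I * θ m) + z * a * (w - 1 - Complex.I * A)
            + (z - 1) * (a * (Complex.I * A)) := by push_cast; ring
      rw [e]
      refine (norm_add₃_le).trans ?_
      have n2 : ‖z * a * (w - 1 - Complex.I * A)‖ ≤ j ^ 2 * ε ^ 2 := by
        rw [norm_mul, norm_mul, hzn, Complex.norm_real, Real.norm_of_nonneg ha0.le, one_mul]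
        calc a * ‖w - 1 - Complex.I * A‖ ≤ 1 * (j ^ 2 * ε ^ 2) := by gcongr
          _ = _ := one_mul _
      have n3 : ‖(z - 1) * (a * (Complex.I * A))‖ ≤ ε * (j * ε) := by
        rw [norm_mul, norm_mul, norm_mul, Complex.norm_I, Complex.norm_real, Complex.norm_real,
          Real.norm_of_nonneg ha0.le, one_mul, Real.norm_eq_abs]
        calc ‖z - 1‖ * (a * |A|) ≤ ε * (1 * (j * ε)) := by gcongr
          _ = _ := by ring
      -- The three errors add up to `(1 + j² + j) ε²`, which is at most `(j + 1)² ε²`.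
      have : (0 : ℝ) ≤ j * ε ^ 2 := by positivity
      push_cast
      nlinarith
    have h := ih (j + 1) _ _ hA' hw'
    have e : inarLogPgf lam a (fun k => Complex.exp (Complex.I * θ k)) (m + 1) w
        - Complex.I * ((lam / (1 - a) * (∑ k ∈ Finset.range (m + 1), θ k + A) : ℝ) : ℂ)
        = lam * (w - 1 - Complex.I * A) +
          (inarLogPgf lam a (fun k => Complex.exp (Complex.I * θ k)) m (z * (1 - a + a * w))
          - Complex.I *
            ((lam / (1 - a) * (∑ k ∈ Finset.range m, θ k + (θ m + a * A)) : ℝ) : ℂ)) := by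
      rw [inarLogPgf, Finset.sum_range_succ, ← hz]
      push_cast
      field_simp
      ring
    rw [e]
    refine (norm_add_le _ _).trans ?_
    rw [norm_mul, Complex.norm_real, Real.norm_of_nonneg hlam.le]
    have b : (j : ℝ) ^ 2 * ε ^ 2 ≤ (j + (m + 1)) ^ 2 * ε ^ 2 := by
      gcongr
      have : (0 : ℝ) ≤ m := by positivity
      linarith
    calc lam * ‖w - 1 - Complex.I * A‖ + _
        ≤ lam * ((j + (m + 1)) ^ 2 * ε ^ 2)
          + lam * (m + 1 / (1 - a)) * (((j + 1 : ℕ) + m) ^ 2 * ε ^ 2) := by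
          gcongr
          exact hw.trans b
      _ = _ := by push_cast; ring

/-- Second order expansion of the logarithm of the generating function, with constants that are
linear in the time horizon. -/
theorem norm_inarLogPgf_sub_second_order_le {lam a ε : ℝ} (hlam : 0 < lam) (ha0 : 0 < a)
    (ha1 : a < 1) (hε : ε ≤ 1) {θ : ℕ → ℝ} (hθ : ∀ k, |θ k| ≤ ε) (m : ℕ) :
    ∀ (w : ℂ) (A C : ℝ), |A| ≤ ε / (1 - a) → |C| ≤ 2 * ε ^ 2 / (1 - a) ^ 2 →
      ‖w - 1 - (Complex.I * A - C / 2)‖ ≤ 3 * ε ^ 3 / (1 - a) ^ 3 →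
      ‖inarLogPgf lam a (fun k => Complex.exp (Complex.I * θ k)) m w
        - (Complex.I * ((lam / (1 - a) * (∑ k ∈ Finset.range m, θ k + A) : ℝ) : ℂ)
          - ((lam / (2 * (1 - a)) * (C + geomQuadForm a θ m
            + 2 * a * A * geomWeightedSum a θ m) : ℝ) : ℂ))‖
        ≤ lam * (m + 1 / (1 - a)) * (3 * ε ^ 3 / (1 - a) ^ 3) := by
  have h1a : 0 < 1 - a := by linarith
  have h1c : (1 - a : ℂ) ≠ 0 := by exact_mod_cast h1a.ne'
  have hε0 : 0 ≤ ε := (abs_nonneg _).trans (hθ 0)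
  -- Here `w = 1 + iA - C/2 + error`, and one step sends `A` to `θ m + a A` and `C` to `θ m ^ 2 + 2
  -- a θ m A + a C`. Each step contracts by the factor `a`, so the three bounds reproduce themselves
  -- and do not grow with `m`: the 2 in the bound for `C` comes from `1 + a ≤ 2`, and the 3 from
  -- three new cubic errors, each at most `ε³ / (1 - a)²`. Only the prefactor `m + 1 / (1 - a)`
  -- accumulates.
  induction m with
  | zero =>
    intro w A C hA hC hw
    have : inarLogPgf lam a (fun k => Complex.exp (Complex.I * θ k)) 0 w
        - (Complex.I * ((lam / (1 - a) * (∑ k ∈ Finset.range 0, θ k + A) : ℝ) : ℂ)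
          - ((lam / (2 * (1 - a)) * (C + geomQuadForm a θ 0
            + 2 * a * A * geomWeightedSum a θ 0) : ℝ) : ℂ))
        = ((lam / (1 - a) : ℝ) : ℂ) * (w - 1 - (Complex.I * A - C / 2)) := by
      simp [inarLogPgf, geomQuadForm, geomWeightedSum]
      field_simp
    rw [this, norm_mul, Complex.norm_real, Real.norm_of_nonneg (by positivity)]
    calc lam / (1 - a) * ‖w - 1 - (Complex.I * A - C / 2)‖
        ≤ lam / (1 - a) * (3 * ε ^ 3 / (1 - a) ^ 3) := by gcongr
      _ = _ := by push_cast; ring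
  | succ m ih =>
    intro w A C hA hC hw
    obtain ⟨hz1, hz2, hz3⟩ := norm_exp_I_sub_le (hθ m) hε
    set z := Complex.exp (Complex.I * θ m) with hz
    have hzn : ‖z‖ = 1 := by rw [hz, mul_comm, Complex.norm_exp_ofReal_mul_I]
    have hA' : |θ m + a * A| ≤ ε / (1 - a) := by
      calc |θ m + a * A| ≤ |θ m| + |a * A| := abs_add_le _ _
        _ ≤ ε + a * (ε / (1 - a)) := by
          rw [abs_mul, abs_of_pos ha0]
          gcongr
          exact hθ m
        _ = _ := by field_simp; ring
    have hC' : |θ m ^ 2 + 2 * a * θ m * A + a * C| ≤ 2 * ε ^ 2 / (1 - a) ^ 2 := by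
      calc |θ m ^ 2 + 2 * a * θ m * A + a * C|
          ≤ |θ m ^ 2| + |2 * a * θ m * A| + |a * C| := abs_add_three _ _ _
        _ = |θ m| ^ 2 + 2 * a * |θ m| * |A| + a * |C| := by
          simp only [abs_mul, abs_of_pos ha0, abs_pow, abs_two]
        _ ≤ ε ^ 2 + 2 * a * ε * (ε / (1 - a)) + a * (2 * ε ^ 2 / (1 - a) ^ 2) := by
          have := hθ m
          gcongr
        _ = ε ^ 2 / (1 - a) ^ 2 * (2 - (1 - a) ^ 2) := by field_simp; ring
        _ ≤ ε ^ 2 / (1 - a) ^ 2 * 2 := by gcongr; nlinarith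
        _ = _ := by ring
    have hw' : ‖z * (1 - a + a * w) - 1 - (Complex.I * ((θ m + a * A : ℝ) : ℂ)
        - ((θ m ^ 2 + 2 * a * θ m * A + a * C : ℝ) : ℂ) / 2)‖ ≤ 3 * ε ^ 3 / (1 - a) ^ 3 := by
      have e : z * (1 - a + a * w) - 1 - (Complex.I * ((θ m + a * A : ℝ) : ℂ)
        - ((θ m ^ 2 + 2 * a * θ m * A + a * C : ℝ) : ℂ) / 2)
          = (z - 1 - Complex.I * θ m + (θ m : ℂ) ^ 2 / 2)
            + z * a * (w - 1 - (Complex.I * A - C / 2))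
            + ((z - 1 - Complex.I * θ m) * (a * (Complex.I * A)) + (z - 1) * (a * (-C / 2))) := by
        push_cast
        linear_combination ((a : ℂ) * A * θ m) * Complex.I_sq
      rw [e]
      refine (norm_add₃_le).trans ?_
      have n2 : ‖z * a * (w - 1 - (Complex.I * A - C / 2))‖ ≤ a * (3 * ε ^ 3 / (1 - a) ^ 3) := by
        rw [norm_mul, norm_mul, hzn, Complex.norm_real, Real.norm_of_nonneg ha0.le, one_mul]
        gcongr
      have n3 : ‖(z - 1 - Complex.I * θ m) * (a * (Complex.I * A))‖
          ≤ ε ^ 2 * (a * (ε / (1 - a))) := by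
        rw [norm_mul, norm_mul, norm_mul, Complex.norm_I, Complex.norm_real, Complex.norm_real,
          Real.norm_of_nonneg ha0.le, one_mul, Real.norm_eq_abs]
        gcongr
      have n4 : ‖(z - 1) * (a * (-C / 2) : ℂ)‖ ≤ ε * (a * (ε ^ 2 / (1 - a) ^ 2)) := by
        rw [norm_mul, norm_mul, norm_div, norm_neg, Complex.norm_real, Complex.norm_real,
          Real.norm_of_nonneg ha0.le, Real.norm_eq_abs, Complex.norm_two]
        have : |C| / 2 ≤ ε ^ 2 / (1 - a) ^ 2 := by
          rw [div_le_iff₀ (by norm_num)]; calc |C| ≤ _ := hC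
            _ = _ := by ring
        gcongr
      refine (add_le_add_three hz3 n2 ((norm_add_le _ _).trans (add_le_add n3 n4))).trans ?_
      have e2 : 3 * ε ^ 3 / (1 - a) ^ 3 - (ε ^ 3 + a * (3 * ε ^ 3 / (1 - a) ^ 3)
          + (ε ^ 2 * (a * (ε / (1 - a))) + ε * (a * (ε ^ 2 / (1 - a) ^ 2))))
          = ε ^ 3 / (1 - a) ^ 2 * (3 - (1 - a) ^ 2 - a * (1 - a) - a) := by
        field_simp; ring
      have : 0 ≤ ε ^ 3 / (1 - a) ^ 2 * (3 - (1 - a) ^ 2 - a * (1 - a) - a) := by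
        apply mul_nonneg (by positivity)
        nlinarith
      linarith
    have h := ih _ _ _ hA' hC' hw'
    have e : inarLogPgf lam a (fun k => Complex.exp (Complex.I * θ k)) (m + 1) w
        - (Complex.I * ((lam / (1 - a) * (∑ k ∈ Finset.range (m + 1), θ k + A) : ℝ) : ℂ)
          - ((lam / (2 * (1 - a)) * (C + geomQuadForm a θ (m + 1)
            + 2 * a * A * geomWeightedSum a θ (m + 1)) : ℝ) : ℂ))
        = lam * (w - 1 - (Complex.I * A - C / 2)) +
          (inarLogPgf lam a (fun k => Complex.exp (Complex.I * θ k)) m (z * (1 - a + a * w))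
          - (Complex.I * ((lam / (1 - a) * (∑ k ∈ Finset.range m, θ k + (θ m + a * A)) : ℝ) : ℂ)
          - ((lam / (2 * (1 - a)) * ((θ m ^ 2 + 2 * a * θ m * A + a * C) + geomQuadForm a θ m
            + 2 * a * (θ m + a * A) * geomWeightedSum a θ m) : ℝ) : ℂ))) := by
      rw [inarLogPgf, Finset.sum_range_succ, geomQuadForm_succ, geomWeightedSum, ← hz]
      push_cast
      field_simp
      ring
    rw [e]
    refine (norm_add_le _ _).trans ?_
    rw [norm_mul, Complex.norm_real, Real.norm_of_nonneg hlam.le]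
    calc _ ≤ lam * (3 * ε ^ 3 / (1 - a) ^ 3)
          + lam * (m + 1 / (1 - a)) * (3 * ε ^ 3 / (1 - a) ^ 3) := by gcongr
      _ = _ := by push_cast; ring

/-- A single power of `1 / (1 - a)` appears, so for a fixed horizon this is an integrable bound in
the random parameter. -/
theorem norm_inarLogChar_le {lam a ε : ℝ} (hlam : 0 < lam) (ha0 : 0 < a)
    (ha1 : a < 1) (hε : ε ≤ 1) {θ : ℕ → ℝ} (hθ : ∀ k, |θ k| ≤ ε) (m : ℕ) :
    ‖inarLogChar lam a θ m‖ ≤ lam * (m + 1 / (1 - a)) * (m ^ 2 * ε ^ 2) := by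
  have h := norm_inarLogPgf_sub_first_order_le hlam ha0 ha1 hε hθ m 0 1 0 (by simp) (by simp)
  simpa [inarLogChar] using h

/-- With `m` of order `n` and `ε` of order `n ^ (-1/2)` the error is still of order `n ^ (-1/2)`.
The four powers of `1 / (1 - a)` need not be integrable, so this serves pointwise limits only. -/
theorem norm_inarLogChar_add_le {lam a ε : ℝ} (hlam : 0 < lam) (ha0 : 0 < a)
    (ha1 : a < 1) (hε : ε ≤ 1) {θ : ℕ → ℝ} (hθ : ∀ k, |θ k| ≤ ε) (m : ℕ) :
    ‖inarLogChar lam a θ m + ((lam / (2 * (1 - a)) * geomQuadForm a θ m : ℝ) : ℂ)‖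
      ≤ lam * (m + 1 / (1 - a)) * (3 * ε ^ 3 / (1 - a) ^ 3) := by
  have hε0 : 0 ≤ ε := (abs_nonneg _).trans (hθ 0)
  have h1a : 0 < 1 - a := by linarith
  have h := norm_inarLogPgf_sub_second_order_le hlam ha0 ha1 hε hθ m 1 0 0
    (by simp; positivity) (by simp; positivity) (by simp; positivity)
  convert h using 2
  simp [inarLogChar]
  ring

/-! ### The process for a fixed thinning parameter -/

/-- A probability measure on the space of noise configurations under which the coordinates are
independent with the distributions of the primitive variables of a stationary INAR(1) process with
thinning parameter `a` and Poisson innovations with mean `lam`. -/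
structure IsINARNoiseLaw (P : Measure (NoiseIndex → ℕ)) (lam a : ℝ) : Prop where
  indep : iIndepFun (fun i (y : NoiseIndex → ℕ) => y i) P
  offspring_one : ∀ k i, P.real ((fun y => y (NoiseIndex.offspring k i)) ⁻¹' {1}) = a
  offspring_zero : ∀ k i, P.real ((fun y => y (NoiseIndex.offspring k i)) ⁻¹' {0}) = 1 - a
  immigration : ∀ k l : ℕ, P.real ((fun y => y (NoiseIndex.immigration k)) ⁻¹' {l})
    = lam ^ l / (l ! : ℝ) * Real.exp (-lam)
  initial : ∀ l : ℕ, P.real ((fun y => y NoiseIndex.initial) ⁻¹' {l})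
    = (lam / (1 - a)) ^ l / (l ! : ℝ) * Real.exp (-(lam / (1 - a)))

/-- The process on the canonical space of noise configurations. -/
abbrev canonicalINAR (k : ℕ) (y : NoiseIndex → ℕ) : ℕ :=
  inarProcess (fun i (y : NoiseIndex → ℕ) => y i) k y

theorem inarProcess_eq_canonicalINAR {Ω : Type*} (Y : NoiseIndex → Ω → ℕ) (k : ℕ) (ω : Ω) :
    inarProcess Y k ω = canonicalINAR k (fun i => Y i ω) := by
  induction k with
  | zero => rfl
  | succ k ih => simp only [canonicalINAR, inarProcess, ih]

/-- The generation which a primitive variable contributes to. -/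
def noiseGeneration : NoiseIndex → ℕ
  | NoiseIndex.initial => 0
  | NoiseIndex.immigration k => k + 1
  | NoiseIndex.offspring k _ => k + 1

/-- The σ-algebra generated by the noise coordinates whose generation lies in `s`. -/
abbrev noiseSigma (s : Set ℕ) : MeasurableSpace (NoiseIndex → ℕ) :=
  ⨆ i ∈ noiseGeneration ⁻¹' s, MeasurableSpace.comap (fun y : NoiseIndex → ℕ => y i) inferInstance

theorem noiseSigma_le (s : Set ℕ) : noiseSigma s ≤ MeasurableSpace.pi :=
  iSup₂_le fun i _ => (measurable_pi_apply i).comap_le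

theorem measurable_eval_noiseSigma {s : Set ℕ} {i : NoiseIndex} (hi : noiseGeneration i ∈ s) :
    Measurable[noiseSigma s] (fun y : NoiseIndex → ℕ => y i) :=
  Measurable.of_comap_le (le_iSup₂_of_le i hi le_rfl)

theorem noiseSigma_mono {s t : Set ℕ} (h : s ⊆ t) : noiseSigma s ≤ noiseSigma t :=
  biSup_mono fun _ hi => h hi

/-- The offspring and immigration variables that produce generation `k + 1`. -/
def generationNoise (k : ℕ) (y : NoiseIndex → ℕ) : (ℕ → ℕ) × ℕ :=
  (fun i => y (NoiseIndex.offspring k i), y (NoiseIndex.immigration k))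

/-- The size of the next generation as a function of the current size and of the noise. -/
def branchingStep (p : ℕ × ((ℕ → ℕ) × ℕ)) : ℕ := ∑ i ∈ Finset.range p.1, p.2.1 i + p.2.2

theorem measurable_branchingStep : Measurable branchingStep := by
  refine measurable_from_prod_countable_right fun n => ?_
  have h : ∀ i : ℕ, Measurable (fun f : (ℕ → ℕ) × ℕ => f.1 i) := fun i =>
    (measurable_pi_apply i).comp measurable_fst
  exact (Finset.measurable_fun_sum (Finset.range n) fun i _ => h i).add measurable_snd

theorem measurable_generationNoise_noiseSigma (k : ℕ) :
    Measurable[noiseSigma {k + 1}] (generationNoise k) := by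
  have h1 : Measurable[noiseSigma {k + 1}]
      (fun (y : NoiseIndex → ℕ) i => y (NoiseIndex.offspring k i)) :=
    @measurable_pi_lambda _ _ _ (noiseSigma {k + 1}) _ _
      fun i => measurable_eval_noiseSigma (by simp [noiseGeneration])
  have h2 : Measurable[noiseSigma {k + 1}]
      (fun (y : NoiseIndex → ℕ) => y (NoiseIndex.immigration k)) :=
    measurable_eval_noiseSigma (by simp [noiseGeneration])
  exact h1.prodMk h2

theorem measurable_canonicalINAR_noiseSigma (k : ℕ) :
    Measurable[noiseSigma (Set.Iic k)] (canonicalINAR k) := by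
  induction k with
  | zero => exact measurable_eval_noiseSigma (by simp [noiseGeneration])
  | succ k ih =>
    have h1 : Measurable[noiseSigma (Set.Iic (k + 1))] (canonicalINAR k) :=
      ih.mono (noiseSigma_mono (Set.Iic_subset_Iic.2 k.le_succ)) le_rfl
    have h2 : Measurable[noiseSigma (Set.Iic (k + 1))] (generationNoise k) :=
      (measurable_generationNoise_noiseSigma k).mono (noiseSigma_mono (by simp)) le_rfl
    exact measurable_branchingStep.comp (@Measurable.prodMk _ _ _ _ _ _ _ _ h1 h2)

theorem measurable_canonicalINAR (k : ℕ) : Measurable (canonicalINAR k) :=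
  (measurable_canonicalINAR_noiseSigma k).mono (noiseSigma_le _) le_rfl

theorem measurable_generationNoise (k : ℕ) : Measurable (generationNoise k) :=
  (measurable_generationNoise_noiseSigma k).mono (noiseSigma_le _) le_rfl

/-! ### Mean and generating function of the Poisson distribution. -/

theorem lintegral_natCast_poissonMeasure (r : ℝ≥0) :
    ∫⁻ n, (n : ℝ≥0∞) ∂(poissonMeasure r) = r := by
  have hs : HasSum (fun n : ℕ => Real.exp (-r) * r ^ n / (n ! : ℝ) * (n : ℝ)) r := by
    -- The term `n = 0` vanishes; after the shift, `n * rⁿ / n!` becomes `r` times the Poisson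
    -- weight of `n - 1`.
    rw [← hasSum_nat_add_iff' 1]
    have h := (hasSum_one_poissonMeasure r).mul_left (r : ℝ)
    simp only [mul_one] at h
    convert! h using 1
    · ext n
      rw [Nat.factorial_succ]
      push_cast
      field_simp
      ring
    · simp
  have hint : Integrable (fun n : ℕ => (n : ℝ)) (poissonMeasure r) := by
    rw [integrable_poissonMeasure_iff]
    simpa using hs.summable
  have h := hasSum_integral_poissonMeasure hint
  simp only [smul_eq_mul] at h
  have h2 := ofReal_integral_eq_lintegral_ofReal hint (ae_of_all _ fun n => by positivity)
  rw [h.unique hs] at h2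
  simpa using h2.symm

theorem integral_pow_poissonMeasure (r : ℝ≥0) (w : ℂ) :
    ∫ n, w ^ n ∂(poissonMeasure r) = Complex.exp (r * (w - 1)) := by
  rw [integral_poissonMeasure]
  have h := (NormedSpace.expSeries_div_hasSum_exp ((r : ℂ) * w)).mul_left (Complex.exp (-r))
  rw [← Complex.exp_eq_exp_ℂ, ← Complex.exp_add] at h
  convert h.tsum_eq using 1
  · refine tsum_congr fun n => ?_
    rw [Complex.real_smul]
    push_cast
    ring
  · congr 1; ring

namespace IsINARNoiseLaw

variable {P : Measure (NoiseIndex → ℕ)} {lam a : ℝ}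

theorem isProbabilityMeasure (h : IsINARNoiseLaw P lam a) : IsProbabilityMeasure P :=
  h.indep.isProbabilityMeasure

theorem map_eq_poissonMeasure [IsFiniteMeasure P] {i : NoiseIndex} {r : ℝ} (hr : 0 ≤ r)
    (h : ∀ l : ℕ, P.real ((fun y => y i) ⁻¹' {l}) = r ^ l / (l ! : ℝ) * Real.exp (-r)) :
    P.map (fun y => y i) = poissonMeasure r.toNNReal := by
  have := Measure.isFiniteMeasure_map P (fun y : NoiseIndex → ℕ => y i)
  refine Measure.ext_of_singleton fun l => ?_
  rw [Measure.map_apply (measurable_pi_apply i) (measurableSet_singleton l),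
    poissonMeasure_singleton, ← ofReal_measureReal, h l, Real.coe_toNNReal _ hr]
  congr 1
  ring

theorem map_immigration (h : IsINARNoiseLaw P lam a) (hlam : 0 < lam) (k : ℕ) :
    P.map (fun y => y (NoiseIndex.immigration k)) = poissonMeasure lam.toNNReal :=
  have := h.isProbabilityMeasure
  map_eq_poissonMeasure hlam.le (h.immigration k)

theorem map_initial (h : IsINARNoiseLaw P lam a) (hlam : 0 < lam) (ha1 : a < 1) :
    P.map (fun y => y NoiseIndex.initial) = poissonMeasure (lam / (1 - a)).toNNReal :=
  have := h.isProbabilityMeasure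
  map_eq_poissonMeasure (div_nonneg hlam.le (by linarith)) h.initial

theorem map_offspring (h : IsINARNoiseLaw P lam a) (ha0 : 0 < a) (ha1 : a < 1) (k i : ℕ) :
    P.map (fun y => y (NoiseIndex.offspring k i))
      = ENNReal.ofReal (1 - a) • Measure.dirac 0 + ENNReal.ofReal a • Measure.dirac 1 := by
  have := h.isProbabilityMeasure
  have hm : Measurable (fun y : NoiseIndex → ℕ => y (NoiseIndex.offspring k i)) :=
    measurable_pi_apply _
  have := Measure.isProbabilityMeasure_map (μ := P) hm.aemeasurable
  set Q := P.map (fun y => y (NoiseIndex.offspring k i)) with hQ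
  have h0 : Q {0} = ENNReal.ofReal (1 - a) := by
    rw [hQ, Measure.map_apply hm (measurableSet_singleton _), ← ofReal_measureReal,
      h.offspring_zero]
  have h1 : Q {1} = ENNReal.ofReal a := by
    rw [hQ, Measure.map_apply hm (measurableSet_singleton _), ← ofReal_measureReal,
      h.offspring_one]
  -- Only the masses at 0 and 1 are prescribed; they sum to one and thereby exclude all other
  -- values.
  have h01 : Q {0, 1} = 1 := by
    rw [Set.insert_eq, measure_union (by simp) (measurableSet_singleton _), h0, h1,
      ← ENNReal.ofReal_add (by linarith) ha0.le]
    simp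
  refine Measure.ext_of_singleton fun n => ?_
  match n with
  | 0 => simp [h0]
  | 1 => simp [h1]
  | n + 2 =>
    have hc : Q {0, 1}ᶜ = 0 := (prob_compl_eq_zero_iff (by measurability)).2 h01
    have : Q {n + 2} = 0 := measure_mono_null (by simp) hc
    simp [this]

theorem integral_pow_offspring (h : IsINARNoiseLaw P lam a) (ha0 : 0 < a) (ha1 : a < 1)
    (k i : ℕ) (w : ℂ) : ∫ y, w ^ y (NoiseIndex.offspring k i) ∂P = 1 - a + a * w := by
  have hm : Measurable (fun y : NoiseIndex → ℕ => y (NoiseIndex.offspring k i)) :=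
    measurable_pi_apply _
  rw [← integral_map (f := fun n : ℕ => w ^ n) hm.aemeasurable
    Measurable.of_discrete.aestronglyMeasurable, h.map_offspring ha0 ha1,
    integral_add_measure, integral_smul_measure, integral_smul_measure, integral_dirac,
    integral_dirac, ENNReal.toReal_ofReal (by linarith), ENNReal.toReal_ofReal ha0.le]
  · simp
  · exact (integrable_dirac (by simp)).smul_measure (by simp)
  · exact (integrable_dirac (by simp)).smul_measure (by simp)

theorem lintegral_offspring (h : IsINARNoiseLaw P lam a) (ha0 : 0 < a) (ha1 : a < 1)
    (k i : ℕ) : ∫⁻ y, (y (NoiseIndex.offspring k i) : ℝ≥0∞) ∂P = ENNReal.ofReal a := by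
  have hm : Measurable (fun y : NoiseIndex → ℕ => y (NoiseIndex.offspring k i)) :=
    measurable_pi_apply _
  rw [← lintegral_map (f := fun n : ℕ => (n : ℝ≥0∞)) Measurable.of_discrete hm,
    h.map_offspring ha0 ha1]
  simp

theorem integral_pow_immigration (h : IsINARNoiseLaw P lam a) (hlam : 0 < lam)
    (k : ℕ) (w : ℂ) :
    ∫ y, w ^ y (NoiseIndex.immigration k) ∂P = Complex.exp (lam * (w - 1)) := by
  have hm : Measurable (fun y : NoiseIndex → ℕ => y (NoiseIndex.immigration k)) :=
    measurable_pi_apply _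
  rw [← integral_map (f := fun n : ℕ => w ^ n) hm.aemeasurable
    Measurable.of_discrete.aestronglyMeasurable, h.map_immigration hlam,
    integral_pow_poissonMeasure, Real.coe_toNNReal _ hlam.le]

theorem lintegral_immigration (h : IsINARNoiseLaw P lam a) (hlam : 0 < lam) (k : ℕ) :
    ∫⁻ y, (y (NoiseIndex.immigration k) : ℝ≥0∞) ∂P = ENNReal.ofReal lam := by
  have hm : Measurable (fun y : NoiseIndex → ℕ => y (NoiseIndex.immigration k)) :=
    measurable_pi_apply _
  rw [← lintegral_map (f := fun n : ℕ => (n : ℝ≥0∞)) Measurable.of_discrete hm,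
    h.map_immigration hlam, lintegral_natCast_poissonMeasure]
  rfl

theorem integral_pow_initial (h : IsINARNoiseLaw P lam a) (hlam : 0 < lam) (ha1 : a < 1)
    (w : ℂ) :
    ∫ y, w ^ y NoiseIndex.initial ∂P = Complex.exp ((lam / (1 - a) : ℝ) * (w - 1)) := by
  have hm : Measurable (fun y : NoiseIndex → ℕ => y NoiseIndex.initial) := measurable_pi_apply _
  rw [← integral_map (f := fun n : ℕ => w ^ n) hm.aemeasurable
    Measurable.of_discrete.aestronglyMeasurable, h.map_initial hlam ha1,
    integral_pow_poissonMeasure, Real.coe_toNNReal _ (div_nonneg hlam.le (by linarith))]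

theorem lintegral_initial (h : IsINARNoiseLaw P lam a) (hlam : 0 < lam) (ha1 : a < 1) :
    ∫⁻ y, (y NoiseIndex.initial : ℝ≥0∞) ∂P = ENNReal.ofReal (lam / (1 - a)) := by
  have hm : Measurable (fun y : NoiseIndex → ℕ => y NoiseIndex.initial) := measurable_pi_apply _
  rw [← lintegral_map (f := fun n : ℕ => (n : ℝ≥0∞)) Measurable.of_discrete hm,
    h.map_initial hlam ha1, lintegral_natCast_poissonMeasure]
  rfl

/-- The noise of generation `k + 1` and that of the generations up to `k` are disjoint blocks of
independent coordinates. This product law is the Markov property of the process. -/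
theorem map_prodMk_generationNoise (h : IsINARNoiseLaw P lam a) {β : Type*} [MeasurableSpace β]
    (k : ℕ) {g : (NoiseIndex → ℕ) → β} (hg : Measurable[noiseSigma (Set.Iic k)] g) :
    P.map (fun y => (g y, generationNoise k y)) = (P.map g).prod (P.map (generationNoise k)) := by
  have := h.isProbabilityMeasure
  have hg' : Measurable g := hg.mono (noiseSigma_le _) le_rfl
  refine (indepFun_iff_map_prod_eq_prod_map_map hg'.aemeasurable
    (measurable_generationNoise k).aemeasurable).1 ?_
  have hi : iIndep (fun i => MeasurableSpace.comap (fun y : NoiseIndex → ℕ => y i) inferInstance)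
      P := h.indep
  have hd : Disjoint (noiseGeneration ⁻¹' Set.Iic k) (noiseGeneration ⁻¹' {k + 1}) :=
    Disjoint.preimage _ (by simp)
  have hI := indep_iSup_of_disjoint (fun i => (measurable_pi_apply i).comap_le) hi hd
  exact indep_of_indep_of_le_left (indep_of_indep_of_le_right hI
    (measurable_generationNoise_noiseSigma k).comap_le) hg.comap_le

theorem integral_pow_branchingStep (h : IsINARNoiseLaw P lam a) (hlam : 0 < lam) (ha0 : 0 < a)
    (ha1 : a < 1) (k n : ℕ) (w : ℂ) :
    ∫ y, w ^ branchingStep (n, generationNoise k y) ∂P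
      = (1 - a + a * w) ^ n * Complex.exp (lam * (w - 1)) := by
  -- `none` carries the immigrants and `some i` the offspring of individual `i`, so that all factors
  -- form one finite independent family.
  let g : Option (Fin n) → NoiseIndex := fun o =>
    o.elim (NoiseIndex.immigration k) (fun i => NoiseIndex.offspring k i)
  have hg : g.Injective := by
    rintro (_ | i) (_ | j) hij <;> simp [g] at hij ⊢
    exact Fin.ext hij
  have hI := (h.indep.precomp hg).integral_fun_prod_comp (f := fun _ (m : ℕ) => w ^ m)
    (fun i => (measurable_pi_apply _).aemeasurable)
    (fun i => Measurable.of_discrete.aestronglyMeasurable)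
  simp only [Fintype.prod_option] at hI
  have e : ∀ y : NoiseIndex → ℕ, w ^ branchingStep (n, generationNoise k y)
      = w ^ y (g none) * ∏ i : Fin n, w ^ y (g (some i)) := by
    intro y
    simp only [branchingStep, generationNoise, g, Option.elim]
    rw [pow_add, mul_comm, ← Finset.prod_pow_eq_pow_sum, Finset.prod_range]
  simp only [e]
  rw [hI]
  simp only [g, Option.elim, h.integral_pow_offspring ha0 ha1, h.integral_pow_immigration hlam]
  simp [mul_comm]

theorem lintegral_branchingStep (h : IsINARNoiseLaw P lam a) (hlam : 0 < lam) (ha0 : 0 < a)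
    (ha1 : a < 1) (k n : ℕ) :
    ∫⁻ y, (branchingStep (n, generationNoise k y) : ℝ≥0∞) ∂P
      = n * ENNReal.ofReal a + ENNReal.ofReal lam := by
  have hm : ∀ i, Measurable (fun y : NoiseIndex → ℕ => (y i : ℝ≥0∞)) := fun i =>
    Measurable.of_discrete.comp (measurable_pi_apply i)
  simp only [branchingStep, generationNoise, Nat.cast_add, Nat.cast_sum]
  rw [lintegral_add_right _ (hm _), lintegral_finsetSum _ (fun i _ => hm _)]
  simp [h.lintegral_offspring ha0 ha1, h.lintegral_immigration hlam]

/-- The conditional generating function of a generation given the past. -/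
theorem integral_mul_pow_succ (h : IsINARNoiseLaw P lam a) (hlam : 0 < lam) (ha0 : 0 < a)
    (ha1 : a < 1) (k : ℕ) {H : (NoiseIndex → ℕ) → ℂ} (hH : Measurable[noiseSigma (Set.Iic k)] H)
    (hH1 : ∀ y, ‖H y‖ ≤ 1) {w : ℂ} (hw : ‖w‖ ≤ 1) :
    ∫ y, H y * w ^ canonicalINAR (k + 1) y ∂P
      = (∫ y, H y * (1 - a + a * w) ^ canonicalINAR k y ∂P) * Complex.exp (lam * (w - 1)) := by
  have := h.isProbabilityMeasure
  let g : (NoiseIndex → ℕ) → ℂ × ℕ := fun y => (H y, canonicalINAR k y)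
  have hg : Measurable[noiseSigma (Set.Iic k)] g :=
    @Measurable.prodMk _ _ _ _ _ _ _ _ hH (measurable_canonicalINAR_noiseSigma k)
  have hg' : Measurable g := hg.mono (noiseSigma_le _) le_rfl
  -- The weight `H` is kept together with the current size as the past; Fubini then freezes the pair
  -- and integrates one branching step with a deterministic number of individuals.
  let F : (ℂ × ℕ) × ((ℕ → ℕ) × ℕ) → ℂ := fun p => p.1.1 * w ^ branchingStep (p.1.2, p.2)
  have hpow : Measurable (fun n : ℕ => w ^ n) := Measurable.of_discrete
  have hF : Measurable F :=
    (measurable_fst.comp measurable_fst).mul (hpow.comp (measurable_branchingStep.comp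
      ((measurable_snd.comp measurable_fst).prodMk measurable_snd)))
  have hgn := measurable_generationNoise k
  have hint : Integrable F ((P.map g).prod (P.map (generationNoise k))) := by
    rw [← h.map_prodMk_generationNoise k hg, integrable_map_measure hF.aestronglyMeasurable
      (hg'.prodMk hgn).aemeasurable]
    refine Integrable.of_bound (hF.comp (hg'.prodMk hgn)).aestronglyMeasurable 1
      (ae_of_all _ fun y => ?_)
    simp only [Function.comp, F, g, norm_mul, norm_pow]
    exact mul_le_one₀ (hH1 y) (by positivity) (pow_le_one₀ (norm_nonneg _) hw)
  calc ∫ y, H y * w ^ canonicalINAR (k + 1) y ∂P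
      = ∫ p, F p ∂(P.map (fun y => (g y, generationNoise k y))) := by
        rw [integral_map (hg'.prodMk hgn).aemeasurable hF.aestronglyMeasurable]
        rfl
    _ = ∫ y, H y * ((1 - a + a * w) ^ canonicalINAR k y * Complex.exp (lam * (w - 1))) ∂P := by
        rw [h.map_prodMk_generationNoise k hg, integral_prod _ hint,
          integral_map hg'.aemeasurable hint.integral_prod_left.aestronglyMeasurable]
        refine integral_congr_ae (ae_of_all _ fun y => ?_)
        simp only
        have hFy : Measurable (fun f => F (g y, f)) := hF.comp measurable_prodMk_left
        rw [integral_map hgn.aemeasurable hFy.aestronglyMeasurable,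
          ← h.integral_pow_branchingStep hlam ha0 ha1 k, ← integral_const_mul]
    _ = _ := by
        rw [← integral_mul_const]
        simp only [mul_assoc]

/-- The joint generating function of the process. -/
theorem integral_prod_pow (h : IsINARNoiseLaw P lam a) (hlam : 0 < lam) (ha0 : 0 < a)
    (ha1 : a < 1) {z : ℕ → ℂ} (hz : ∀ k, ‖z k‖ ≤ 1) (m : ℕ) :
    ∀ {w : ℂ}, ‖w‖ ≤ 1 →
      ∫ y, (∏ k ∈ Finset.range m, z k ^ canonicalINAR k y) * w ^ canonicalINAR m y ∂P
        = Complex.exp (inarLogPgf lam a z m w) := by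
  induction m with
  | zero =>
    intro w hw
    simpa [inarLogPgf] using! h.integral_pow_initial hlam ha1 w
  | succ m ih =>
    intro w hw
    have hpow : ∀ c : ℂ, Measurable (fun n : ℕ => c ^ n) := fun c => Measurable.of_discrete
    have hH : Measurable[noiseSigma (Set.Iic m)]
        (fun y => ∏ k ∈ Finset.range (m + 1), z k ^ canonicalINAR k y) := by
      refine @Finset.measurable_fun_prod _ _ _ _ _ _ (noiseSigma (Set.Iic m)) _ _ fun k hk => ?_
      exact (hpow (z k)).comp ((measurable_canonicalINAR_noiseSigma k).mono
        (noiseSigma_mono (Set.Iic_subset_Iic.2 (Nat.lt_succ_iff.1 (Finset.mem_range.1 hk)))) le_rfl)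
    rw [h.integral_mul_pow_succ hlam ha0 ha1 m hH ?_ hw, inarLogPgf, Complex.exp_add,
      ← ih (norm_thinning_le_one ha0 ha1 (hz m) hw), mul_comm]
    -- The factors `z m ^ X_m` and `(1 - a + a w) ^ X_m` merge into one power, whence the new
    -- argument in the recursion.
    · congr 2
      ext y
      rw [Finset.prod_range_succ, mul_pow, mul_assoc]
    · intro y
      rw [norm_prod]
      refine Finset.prod_le_one (fun _ _ => norm_nonneg _) fun k _ => ?_
      rw [norm_pow]
      exact pow_le_one₀ (norm_nonneg _) (hz k)

/-- The process is stationary in mean. -/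
theorem lintegral_canonicalINAR (h : IsINARNoiseLaw P lam a) (hlam : 0 < lam) (ha0 : 0 < a)
    (ha1 : a < 1) (k : ℕ) :
    ∫⁻ y, (canonicalINAR k y : ℝ≥0∞) ∂P = ENNReal.ofReal (lam / (1 - a)) := by
  have := h.isProbabilityMeasure
  -- Extended nonnegative integrals allow this induction before the mean is known to be finite; `lam
  -- / (1 - a)` is the fixed point of `x ↦ a x + lam`.
  induction k with
  | zero => exact h.lintegral_initial hlam ha1
  | succ k ih =>
    have hX := measurable_canonicalINAR k
    have hX' : Measurable (fun y => (canonicalINAR k y : ℝ≥0∞)) :=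
      (Measurable.of_discrete (f := fun n : ℕ => (n : ℝ≥0∞))).comp hX
    have hgn := measurable_generationNoise k
    have hcast : Measurable (fun n : ℕ => (n : ℝ≥0∞)) := Measurable.of_discrete
    have hF : Measurable (fun p : ℕ × ((ℕ → ℕ) × ℕ) => (branchingStep p : ℝ≥0∞)) :=
      hcast.comp measurable_branchingStep
    calc ∫⁻ y, (canonicalINAR (k + 1) y : ℝ≥0∞) ∂P
        = ∫⁻ p, (branchingStep p : ℝ≥0∞)
            ∂(P.map (fun y => (canonicalINAR k y, generationNoise k y))) := by
          rw [lintegral_map hF (hX.prodMk hgn)]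
          rfl
      _ = ∫⁻ y, ((canonicalINAR k y : ℝ≥0∞) * ENNReal.ofReal a + ENNReal.ofReal lam) ∂P := by
          rw [h.map_prodMk_generationNoise k (measurable_canonicalINAR_noiseSigma k),
            lintegral_prod _ hF.aemeasurable, lintegral_map hF.lintegral_prod_right' hX]
          refine lintegral_congr fun y => ?_
          have hFy : Measurable
              (fun f => (branchingStep (canonicalINAR k y, f) : ℝ≥0∞)) :=
            hF.comp measurable_prodMk_left
          rw [lintegral_map hFy hgn]
          exact h.lintegral_branchingStep hlam ha0 ha1 k _
      _ = ENNReal.ofReal (lam / (1 - a)) * ENNReal.ofReal a + ENNReal.ofReal lam := by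
          rw [lintegral_add_right _ measurable_const, lintegral_mul_const _ hX', ih]
          simp
      _ = ENNReal.ofReal (lam / (1 - a)) := by
          have h1a : 0 < 1 - a := by linarith
          rw [← ENNReal.ofReal_mul (by positivity), ← ENNReal.ofReal_add (by positivity) hlam.le]
          congr 1
          field_simp
          ring

theorem integral_canonicalINAR (h : IsINARNoiseLaw P lam a) (hlam : 0 < lam) (ha0 : 0 < a)
    (ha1 : a < 1) (k : ℕ) : ∫ y, (canonicalINAR k y : ℝ) ∂P = lam / (1 - a) := by
  have hX : Measurable (fun y => (canonicalINAR k y : ℝ)) :=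
    (Measurable.of_discrete (f := fun n : ℕ => (n : ℝ))).comp (measurable_canonicalINAR k)
  rw [integral_eq_lintegral_of_nonneg_ae (ae_of_all _ fun y => by positivity)
    hX.aestronglyMeasurable]
  simp only [ENNReal.ofReal_natCast, h.lintegral_canonicalINAR hlam ha0 ha1 k]
  exact ENNReal.toReal_ofReal (div_nonneg hlam.le (by linarith))

end IsINARNoiseLaw

/-! ### The conditional law of the primitive variables -/

instance : Countable NoiseIndex := by
  let f : NoiseIndex → Option (ℕ ⊕ ℕ × ℕ)
    | NoiseIndex.initial => none
    | NoiseIndex.immigration k => some (Sum.inl k)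
    | NoiseIndex.offspring k i => some (Sum.inr (k, i))
  refine Function.Injective.countable (f := f) ?_
  rintro (_ | k | ⟨k, i⟩) (_ | l | ⟨l, j⟩) h <;> simp_all [f]

/-- Preimages of singletons form a π-system, since two that meet coincide, and they generate because
`ℕ` is countable. Independence thus becomes a family of identities between point probabilities,
which is countable when the index set is. -/
theorem iIndepFun_eval_of_singletons {ι : Type*} {P : Measure (ι → ℕ)}
    (h : ∀ (s : Finset ι) (n : ι → ℕ), P (⋂ i ∈ s, (fun y : ι → ℕ => y i) ⁻¹' {n i})
      = ∏ i ∈ s, P ((fun y : ι → ℕ => y i) ⁻¹' {n i})) :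
    iIndepFun (fun i (y : ι → ℕ) => y i) P := by
  have key : iIndep (fun i => MeasurableSpace.comap (fun y : ι → ℕ => y i) inferInstance) P := by
    refine iIndepSets.iIndep (fun i => (measurable_pi_apply i).comap_le)
      (fun i => Set.range fun n => (fun y : ι → ℕ => y i) ⁻¹' {n}) ?_ ?_ ?_
    · rintro i _ ⟨n, rfl⟩ _ ⟨m, rfl⟩ ⟨y, hy1, hy2⟩
      simp only [Set.mem_preimage, Set.mem_singleton_iff] at hy1 hy2
      exact ⟨n, by simp [← hy1, ← hy2]⟩
    · intro i
      have : (inferInstance : MeasurableSpace ℕ)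
          = MeasurableSpace.generateFrom (Set.range fun n : ℕ => {n}) := by
        refine le_antisymm (fun t _ => ?_) (MeasurableSpace.generateFrom_le ?_)
        · rw [← Set.biUnion_of_singleton t]
          exact MeasurableSet.biUnion t.to_countable fun n _ =>
            MeasurableSpace.measurableSet_generateFrom ⟨n, rfl⟩
        · rintro _ ⟨n, rfl⟩
          exact measurableSet_singleton n
      rw [this, MeasurableSpace.comap_generateFrom, ← Set.range_comp]
      rfl
    · rw [iIndepSets_iff]
      intro s f hf
      choose! n hn using hf
      have hs := h s n
      rw [Finset.prod_congr rfl fun i hi => by rw [← hn i hi]]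
      rw [← hs]
      congr 1
      exact Set.iInter₂_congr fun i hi => (hn i hi).symm
  exact key

theorem IsRandomizedINARNoise.measurable_noise_pi {Ω : Type*} [MeasurableSpace Ω] {μ : Measure Ω}
    {lam : ℝ} {a : Ω → ℝ} {Y : NoiseIndex → Ω → ℕ} (hY : IsRandomizedINARNoise μ lam a Y) :
    Measurable (fun ω i => Y i ω) :=
  measurable_pi_lambda _ hY.measurable_noise

namespace IsRandomizedINARNoise

variable {Ω : Type*} [MeasurableSpace Ω] {μ : Measure Ω} [IsProbabilityMeasure μ]
  {lam : ℝ} {a : Ω → ℝ} {Y : NoiseIndex → Ω → ℕ}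

/-- Conditionally on the thinning parameter, the primitive variables are almost surely those of an
INAR(1) process with a fixed thinning parameter. -/
theorem ae_isINARNoiseLaw (hY : IsRandomizedINARNoise μ lam a Y) :
    ∀ᵐ ω ∂μ, IsINARNoiseLaw (condDistrib (fun ω i => Y i ω) a μ (a ω)) lam (a ω) := by
  have hc : ∀ {s : Set (NoiseIndex → ℕ)}, MeasurableSet s →
      (fun ω => (condDistrib (fun ω i => Y i ω) a μ (a ω)).real s)
        =ᵐ[μ] μ⟦(fun ω i => Y i ω) ⁻¹' s | sigmaOf a⟧ := fun hs =>
    condDistrib_ae_eq_condExp hY.measurable_param hY.measurable_noise_pi hs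
  have hcoord : ∀ (i : NoiseIndex) (A : Set ℕ),
      (fun ω => (condDistrib (fun ω i => Y i ω) a μ (a ω)).real ((fun y => y i) ⁻¹' A))
        =ᵐ[μ] μ⟦Y i ⁻¹' A | sigmaOf a⟧ := fun i A =>
    hc (measurable_pi_apply i (MeasurableSet.of_discrete))
  -- The index `p` is a finite set of coordinates with prescribed values on it. There are only
  -- countably many such `p`, so the almost sure product formulas hold simultaneously off one null
  -- set.
  let A : (p : Σ s : Finset NoiseIndex, (s → ℕ)) → NoiseIndex → Set ℕ := fun p i =>
    open Classical in if h : i ∈ p.1 then {p.2 ⟨i, h⟩} else Set.univ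
  have hind : ∀ᵐ ω ∂μ, ∀ p : Σ s : Finset NoiseIndex, (s → ℕ),
      (condDistrib (fun ω i => Y i ω) a μ (a ω)).real (⋂ i ∈ p.1, (fun y => y i) ⁻¹' A p i)
        = ∏ i ∈ p.1, (condDistrib (fun ω i => Y i ω) a μ (a ω)).real
            ((fun y => y i) ⁻¹' A p i) := by
    refine ae_all_iff.2 fun p => ?_
    have h1 := hc (s := ⋂ i ∈ p.1, (fun y => y i) ⁻¹' A p i)
      (Finset.measurableSet_biInter _ fun i _ =>
        measurable_pi_apply i (MeasurableSet.of_discrete))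
    have h2 := hY.condIndep p.1 (A p) fun _ _ => MeasurableSet.of_discrete
    have h3 : ∀ᵐ ω ∂μ, ∀ i ∈ p.1,
        (condDistrib (fun ω i => Y i ω) a μ (a ω)).real ((fun y => y i) ⁻¹' A p i)
          = (μ⟦Y i ⁻¹' A p i | sigmaOf a⟧) ω :=
      (Filter.eventually_all_finset p.1).2 fun i _ => hcoord i (A p i)
    have e : (fun ω i => Y i ω) ⁻¹' (⋂ i ∈ p.1, (fun y : NoiseIndex → ℕ => y i) ⁻¹' A p i)
        = ⋂ i ∈ p.1, Y i ⁻¹' A p i := by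
      simp only [Set.preimage_iInter]
      rfl
    rw [e] at h1
    filter_upwards [h1, h2, h3] with ω w1 w2 w3
    rw [w1, w2, Finset.prod_apply]
    exact Finset.prod_congr rfl fun i hi => (w3 i hi).symm
  have ho1 := ae_all_iff.2 fun k => ae_all_iff.2 fun i =>
    (hcoord (NoiseIndex.offspring k i) {1}).trans (hY.offspring_one k i)
  have ho0 := ae_all_iff.2 fun k => ae_all_iff.2 fun i =>
    (hcoord (NoiseIndex.offspring k i) {0}).trans (hY.offspring_zero k i)
  have him := ae_all_iff.2 fun k => ae_all_iff.2 fun l =>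
    (hcoord (NoiseIndex.immigration k) {l}).trans (hY.immigration k l)
  have hin := ae_all_iff.2 fun l => (hcoord NoiseIndex.initial {l}).trans (hY.initial l)
  filter_upwards [hind, ho1, ho0, him, hin] with ω w1 w2 w3 w4 w5
  refine ⟨iIndepFun_eval_of_singletons fun s n => ?_, w2, w3, w4, w5⟩
  have h := w1 ⟨s, fun i => n i⟩
  have hA : ∀ i ∈ s, A ⟨s, fun i => n i⟩ i = {n i} := fun i hi => by simp [A, hi]
  have hI : (⋂ i ∈ s, (fun y : NoiseIndex → ℕ => y i) ⁻¹' A ⟨s, fun i => n i⟩ i)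
      = ⋂ i ∈ s, (fun y : NoiseIndex → ℕ => y i) ⁻¹' {n i} :=
    Set.iInter₂_congr fun i hi => by rw [hA i hi]
  simp only [hI] at h
  rw [Finset.prod_congr rfl fun i hi => by rw [hA i hi]] at h
  rw [← ofReal_measureReal, h, ENNReal.ofReal_prod_of_nonneg fun _ _ => measureReal_nonneg]
  exact Finset.prod_congr rfl fun i _ => ofReal_measureReal

/-- Disintegrating along the thinning parameter gives mean `E (lam / (1 - a))`, which is finite by
`hint`. -/
theorem integrable_canonicalINAR (hY : IsRandomizedINARNoise μ lam a Y) (hlam : 0 < lam)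
    (ha : ∀ᵐ ω ∂μ, a ω ∈ Set.Ioo (0 : ℝ) 1) (hint : Integrable (fun ω => 1 / (1 - a ω)) μ)
    (k : ℕ) : Integrable (fun ω => (canonicalINAR k (fun i => Y i ω) : ℝ)) μ := by
  have hm : Measurable (fun y => (canonicalINAR k y : ℝ)) :=
    (Measurable.of_discrete (f := fun n : ℕ => (n : ℝ))).comp (measurable_canonicalINAR k)
  have hm' : Measurable (fun y => (canonicalINAR k y : ℝ≥0∞)) :=
    (Measurable.of_discrete (f := fun n : ℕ => (n : ℝ≥0∞))).comp (measurable_canonicalINAR k)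
  have hYm := hY.measurable_noise_pi
  refine ⟨(hm.comp hYm).aestronglyMeasurable, ?_⟩
  rw [hasFiniteIntegral_iff_ofReal (ae_of_all _ fun ω => by positivity)]
  simp only [ENNReal.ofReal_natCast]
  have e : ∫⁻ ω, (canonicalINAR k (fun i => Y i ω) : ℝ≥0∞) ∂μ
      = ∫⁻ ω, ENNReal.ofReal (lam / (1 - a ω)) ∂μ := by
    have hs : Measurable (fun p : ℝ × (NoiseIndex → ℕ) => (canonicalINAR k p.2 : ℝ≥0∞)) :=
      hm'.comp measurable_snd
    have h1 : ∫⁻ ω, (canonicalINAR k (fun i => Y i ω) : ℝ≥0∞) ∂μ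
        = ∫⁻ p, (canonicalINAR k p.2 : ℝ≥0∞) ∂(μ.map fun ω => (a ω, fun i => Y i ω)) := by
      rw [lintegral_map hs (hY.measurable_param.prodMk hYm)]
    rw [h1, ← compProd_map_condDistrib hYm.aemeasurable, Measure.lintegral_compProd hs,
      lintegral_map hs.lintegral_kernel_prod_right' hY.measurable_param]
    refine lintegral_congr_ae ?_
    filter_upwards [hY.ae_isINARNoiseLaw, ha] with ω hω haω
    exact hω.lintegral_canonicalINAR hlam haω.1 haω.2 k
  rw [e]
  have h2 : Integrable (fun ω => lam / (1 - a ω)) μ := by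
    simpa [div_eq_mul_inv] using hint.const_mul lam
  exact h2.lintegral_lt_top

/-- Stationarity in mean under the conditional law makes the centring explicit and independent of
`k`. -/
theorem condExp_inarProcess_ae_eq (hY : IsRandomizedINARNoise μ lam a Y) (hlam : 0 < lam)
    (ha : ∀ᵐ ω ∂μ, a ω ∈ Set.Ioo (0 : ℝ) 1) (hint : Integrable (fun ω => 1 / (1 - a ω)) μ)
    (k : ℕ) : μ[fun ω => (inarProcess Y k ω : ℝ) | sigmaOf a] =ᵐ[μ] fun ω => lam / (1 - a ω) := by
  have hm : Measurable (fun y => (canonicalINAR k y : ℝ)) :=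
    (Measurable.of_discrete (f := fun n : ℕ => (n : ℝ))).comp (measurable_canonicalINAR k)
  simp only [inarProcess_eq_canonicalINAR]
  refine (condExp_ae_eq_integral_condDistrib hY.measurable_param
    hY.measurable_noise_pi.aemeasurable hm.stronglyMeasurable
    (hY.integrable_canonicalINAR hlam ha hint k)).trans ?_
  filter_upwards [hY.ae_isINARNoiseLaw, ha] with ω hω haω
  exact hω.integral_canonicalINAR hlam haω.1 haω.2 k

end IsRandomizedINARNoise

/-- The weighted sum of the conditionally centred values of the process, as a function of the
thinning parameter and of the noise. -/
noncomputable def centredSum (lam : ℝ) (θ : ℕ → ℝ) (m : ℕ) (p : ℝ × (NoiseIndex → ℕ)) : ℝ :=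
  ∑ k ∈ Finset.range m, θ k * ((canonicalINAR k p.2 : ℝ) - lam / (1 - p.1))

theorem measurable_centredSum (lam : ℝ) (θ : ℕ → ℝ) (m : ℕ) :
    Measurable (centredSum lam θ m) := by
  refine Finset.measurable_fun_sum _ fun k _ => ?_
  have h : Measurable (fun p : ℝ × (NoiseIndex → ℕ) => (canonicalINAR k p.2 : ℝ)) :=
    (Measurable.of_discrete (f := fun n : ℕ => (n : ℝ))).comp
      ((measurable_canonicalINAR k).comp measurable_snd)
  fun_prop

theorem IsINARNoiseLaw.integral_exp_centredSum {P : Measure (NoiseIndex → ℕ)} {lam a : ℝ}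
    (h : IsINARNoiseLaw P lam a) (hlam : 0 < lam) (ha0 : 0 < a) (ha1 : a < 1) (θ : ℕ → ℝ)
    (m : ℕ) : ∫ y, Complex.exp (Complex.I * centredSum lam θ m (a, y)) ∂P
      = Complex.exp (inarLogChar lam a θ m) := by
  have hp := h.integral_prod_pow hlam ha0 ha1 (z := fun k => Complex.exp (Complex.I * θ k))
    (fun k => by rw [mul_comm, Complex.norm_exp_ofReal_mul_I]) m (w := 1) (by simp)
  rw [inarLogChar, sub_eq_add_neg, Complex.exp_add, ← hp, ← integral_mul_const]
  congr 1
  ext y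
  simp only [one_pow, mul_one, ← Complex.exp_nat_mul, ← Complex.exp_sum, ← Complex.exp_add,
    centredSum]
  congr 1
  push_cast
  simp only [Finset.mul_sum, mul_sub, Finset.sum_sub_distrib]
  rw [sub_eq_add_neg]
  congr 1
  · exact Finset.sum_congr rfl fun k _ => by ring
  · congr 1
    exact Finset.sum_congr rfl fun k _ => by ring

theorem IsRandomizedINARNoise.integral_exp_centredSum {Ω : Type*} [MeasurableSpace Ω]
    {μ : Measure Ω} [IsProbabilityMeasure μ] {lam : ℝ} {a : Ω → ℝ} {Y : NoiseIndex → Ω → ℕ}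
    (hY : IsRandomizedINARNoise μ lam a Y) (hlam : 0 < lam)
    (ha : ∀ᵐ ω ∂μ, a ω ∈ Set.Ioo (0 : ℝ) 1) (θ : ℕ → ℝ) (m : ℕ) :
    ∫ ω, Complex.exp (Complex.I * centredSum lam θ m (a ω, fun i => Y i ω)) ∂μ
      = ∫ ω, Complex.exp (inarLogChar lam (a ω) θ m) ∂μ := by
  have hS := measurable_centredSum lam θ m
  have hf : Measurable
      (fun p : ℝ × (NoiseIndex → ℕ) => Complex.exp (Complex.I * centredSum lam θ m p)) := by
    fun_prop
  have hint : Integrable (fun ω => Complex.exp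
      (Complex.I * centredSum lam θ m (a ω, fun i => Y i ω))) μ := by
    refine Integrable.of_bound (hf.comp
      (hY.measurable_param.prodMk hY.measurable_noise_pi)).aestronglyMeasurable 1
      (ae_of_all _ fun ω => ?_)
    rw [mul_comm, Complex.norm_exp_ofReal_mul_I]
  have h := condExp_prod_ae_eq_integral_condDistrib hY.measurable_param
    hY.measurable_noise_pi.aemeasurable hf.stronglyMeasurable hint
  rw [← integral_condExp hY.measurable_param.comap_le, integral_congr_ae h]
  refine integral_congr_ae ?_
  filter_upwards [hY.ae_isINARNoiseLaw, ha] with ω hω haω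
  exact hω.integral_exp_centredSum hlam haω.1 haω.2 θ m

/-- The argument `w` must be allowed to depend on `a`, because the recursion makes it do so after
one step. -/
theorem measurable_inarLogPgf (lam : ℝ) (z : ℕ → ℂ) (m : ℕ) :
    ∀ {w : ℝ → ℂ}, Measurable w → Measurable (fun a => inarLogPgf lam a z m (w a)) := by
  induction m with
  | zero => intro w hw; simp only [inarLogPgf]; fun_prop
  | succ m ih =>
    intro w hw
    simp only [inarLogPgf]
    exact (by fun_prop : Measurable fun a => (lam : ℂ) * (w a - 1)).add (ih (by fun_prop))

theorem measurable_inarLogChar (lam : ℝ) (θ : ℕ → ℝ) (m : ℕ) :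
    Measurable (fun a => inarLogChar lam a θ m) := by
  have := measurable_inarLogPgf lam (fun k => Complex.exp (Complex.I * θ k)) m
    (w := fun _ => 1) measurable_const
  unfold inarLogChar
  fun_prop

/-! ### Convergence of finite-dimensional distributions -/

/-- The characteristic function needs an inner product, so the law on `I → ℝ` is first transported
to Euclidean space. -/
theorem charFun_map_toLp_restrict {T Ω : Type*} [MeasurableSpace Ω] {μ : Measure Ω}
    {Z : T → Ω → ℝ} (hZ : ∀ t, AEMeasurable (Z t) μ) (I : Finset T) (u : EuclideanSpace ℝ I) :
    charFun ((μ.map (fun ω => I.restrict (Z · ω))).map (WithLp.toLp 2)) u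
      = ∫ ω, Complex.exp (Complex.I * ((∑ t : I, u t * Z t ω : ℝ) : ℂ)) ∂μ := by
  have hm : AEMeasurable (fun ω => I.restrict (Z · ω)) μ :=
    aemeasurable_pi_lambda _ fun t => hZ t
  have hLp : Measurable (WithLp.toLp 2 : (I → ℝ) → EuclideanSpace ℝ I) := by fun_prop
  rw [AEMeasurable.map_map_of_aemeasurable hLp.aemeasurable hm, charFun_apply,
    integral_map (hLp.comp_aemeasurable hm) (by fun_prop)]
  congr 1
  ext ω
  rw [mul_comm]
  congr 3

/-- Lévy's continuity theorem on Euclidean space, carried back to `I → ℝ` by the continuous inverse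
of `WithLp.toLp 2`. -/
theorem tendstoFDD_of_tendsto_charFun {T Ω' : Type*} {Ω : ℕ → Type*}
    {mΩ : ∀ i, MeasurableSpace (Ω i)} {mΩ' : MeasurableSpace Ω'} {Z : (i : ℕ) → T → Ω i → ℝ}
    {W : T → Ω' → ℝ} {μ : (i : ℕ) → Measure (Ω i)} [∀ i, IsProbabilityMeasure (μ i)]
    {ν : Measure Ω'} [IsProbabilityMeasure ν] (hZ : ∀ i t, AEMeasurable (Z i t) (μ i))
    (hW : ∀ t, AEMeasurable (W t) ν)
    (h : ∀ (I : Finset T) (u : I → ℝ), Tendsto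
      (fun i => ∫ ω, Complex.exp (Complex.I * ((∑ t : I, u t * Z i t ω : ℝ) : ℂ)) ∂(μ i)) atTop
      (𝓝 (∫ ω, Complex.exp (Complex.I * ((∑ t : I, u t * W t ω : ℝ) : ℂ)) ∂ν))) :
    TendstoFDD Z atTop W μ ν := by
  intro I
  have hm : ∀ i, AEMeasurable (fun ω => I.restrict (Z i · ω)) (μ i) := fun i =>
    aemeasurable_pi_lambda _ fun t => hZ i t
  have hm' : AEMeasurable (fun ω => I.restrict (W · ω)) ν :=
    aemeasurable_pi_lambda _ fun t => hW t
  refine ⟨hm, hm', ?_⟩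
  have hLp : Continuous (WithLp.toLp 2 : (I → ℝ) → EuclideanSpace ℝ I) :=
    PiLp.continuous_toLp 2 _
  have hLp' : Continuous (WithLp.ofLp : EuclideanSpace ℝ I → (I → ℝ)) :=
    PiLp.continuous_ofLp 2 _
  let p : ℕ → ProbabilityMeasure (I → ℝ) := fun i =>
    ⟨(μ i).map (fun ω => I.restrict (Z i · ω)), Measure.isProbabilityMeasure_map (hm i)⟩
  let q : ProbabilityMeasure (I → ℝ) :=
    ⟨ν.map (fun ω => I.restrict (W · ω)), Measure.isProbabilityMeasure_map hm'⟩
  change Tendsto p atTop (𝓝 q)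
  have h1 : Tendsto (fun i => (p i).map hLp.measurable.aemeasurable) atTop
      (𝓝 (q.map hLp.measurable.aemeasurable)) := by
    refine ProbabilityMeasure.tendsto_of_tendsto_charFun fun u => ?_
    have e1 : ∀ i, charFun ((p i).map hLp.measurable.aemeasurable :
        Measure (EuclideanSpace ℝ I)) u
        = ∫ ω, Complex.exp (Complex.I * ((∑ t : I, u t * Z i t ω : ℝ) : ℂ)) ∂(μ i) := fun i =>
      charFun_map_toLp_restrict (hZ i) I u
    have e2 : charFun (q.map hLp.measurable.aemeasurable : Measure (EuclideanSpace ℝ I)) u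
        = ∫ ω, Complex.exp (Complex.I * ((∑ t : I, u t * W t ω : ℝ) : ℂ)) ∂ν :=
      charFun_map_toLp_restrict hW I u
    simp only [e1, e2]
    exact h I u
  have h2 := ProbabilityMeasure.tendsto_map_of_tendsto_of_continuous _ _ h1 hLp'
  have e : ∀ r : ProbabilityMeasure (I → ℝ),
      (r.map hLp.measurable.aemeasurable).map hLp'.measurable.aemeasurable = r := by
    intro r
    apply Subtype.ext
    change ((r : Measure (I → ℝ)).map (WithLp.toLp 2)).map WithLp.ofLp = r
    rw [Measure.map_map hLp'.measurable hLp.measurable]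
    exact Measure.map_id
  simpa only [e] using h2

/-- If `N (f_N - 1) → c` then `f_N ^ N → exp c`. -/
theorem tendsto_pow_of_tendsto_natCast_mul_sub_one {f : ℕ → ℂ} {c : ℂ}
    (h : Tendsto (fun N : ℕ => (N : ℂ) * (f N - 1)) atTop (𝓝 c)) :
    Tendsto (fun N : ℕ => f N ^ N) atTop (𝓝 (Complex.exp c)) := by
  have := Complex.tendsto_one_add_pow_exp_of_tendsto h
  simpa using this

/-- For large `x` the trivial bound 2 suffices, so no smallness is needed. This matters for
domination, where the exponent is not small uniformly in the random parameter. -/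
theorem norm_exp_sub_one_le_two_mul {x : ℂ} (hx : ‖Complex.exp x‖ ≤ 1) :
    ‖Complex.exp x - 1‖ ≤ 2 * ‖x‖ := by
  by_cases h : ‖x‖ ≤ 1
  · exact Complex.norm_exp_sub_one_le h
  · calc ‖Complex.exp x - 1‖ ≤ ‖Complex.exp x‖ + ‖(1 : ℂ)‖ := norm_sub_le _ _
      _ ≤ 1 + 1 := by simpa using hx
      _ ≤ 2 * ‖x‖ := by linarith

/-- Convergence of `N f_N` forces `f_N → 0`, hence the quadratic remainder `N f_N²` vanishes. -/
theorem tendsto_natCast_mul_exp_sub_one {f : ℕ → ℂ} {c : ℂ}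
    (h : Tendsto (fun N : ℕ => (N : ℂ) * f N) atTop (𝓝 c)) :
    Tendsto (fun N : ℕ => (N : ℂ) * (Complex.exp (f N) - 1)) atTop (𝓝 c) := by
  have h0 : Tendsto f atTop (𝓝 0) := by
    have h1 : Tendsto (fun N : ℕ => ((N : ℂ))⁻¹) atTop (𝓝 0) := tendsto_inv_atTop_nhds_zero_nat
    have h2 := h1.mul h
    rw [zero_mul] at h2
    refine h2.congr' ?_
    filter_upwards [eventually_ne_atTop 0] with N hN
    have : (N : ℂ) ≠ 0 := by exact_mod_cast hN
    field_simp
  have h3 : Tendsto (fun N : ℕ => (N : ℂ) * (Complex.exp (f N) - 1 - f N)) atTop (𝓝 0) := by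
    have hb : Tendsto (fun N : ℕ => ‖(N : ℂ) * f N‖ * ‖f N‖) atTop (𝓝 0) := by
      simpa using h.norm.mul h0.norm
    refine squeeze_zero_norm' ?_ hb
    have : ∀ᶠ N in atTop, ‖f N‖ ≤ 1 :=
      (h0.norm.eventually (ge_mem_nhds (by simp : ‖(0 : ℂ)‖ < 1)))
    filter_upwards [this] with N hN
    rw [norm_mul, norm_mul, mul_assoc, ← sq]
    gcongr
    exact Complex.norm_exp_sub_one_sub_id_le hN
  have h4 := h3.add h
  rw [zero_add] at h4
  refine h4.congr fun N => by ring

/-! ### Asymptotics of the quadratic form -/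

theorem sum_geom_dist_Icc {a : ℝ} {k q : ℕ} (hkq : k ≤ q) :
    (∑ l ∈ Finset.Icc 1 q, a ^ Nat.dist k l) * (1 - a) = 1 + a - a ^ k - a ^ (q + 1 - k) := by
  have base : ∀ k : ℕ, (∑ l ∈ Finset.Icc 1 k, a ^ Nat.dist k l) * (1 - a) = 1 - a ^ k := by
    intro k
    induction k with
    | zero => simp
    | succ k ih =>
      rw [Finset.sum_Icc_succ_top (by omega), Nat.dist_self]
      have : ∑ l ∈ Finset.Icc 1 k, a ^ Nat.dist (k + 1) l
          = a * ∑ l ∈ Finset.Icc 1 k, a ^ Nat.dist k l := by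
        rw [Finset.mul_sum]
        refine Finset.sum_congr rfl fun l hl => ?_
        have hl := Finset.mem_Icc.1 hl
        have : Nat.dist (k + 1) l = Nat.dist k l + 1 := by simp only [Nat.dist]; omega
        rw [this]; ring
      rw [this]
      linear_combination a * ih
  induction q, hkq using Nat.le_induction with
  | base =>
    rw [base]
    have : k + 1 - k = 1 := by omega
    rw [this]; ring
  | succ q hq ih =>
    rw [Finset.sum_Icc_succ_top (by omega), add_mul, ih]
    have h1 : Nat.dist k (q + 1) = q + 1 - k := by simp only [Nat.dist]; omega
    have h2 : q + 1 + 1 - k = (q + 1 - k) + 1 := by omega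
    rw [h1, h2]; ring

theorem sum_pow_Icc_le {a : ℝ} (ha0 : 0 < a) (ha1 : a < 1) (p : ℕ) :
    ∑ k ∈ Finset.Icc 1 p, a ^ k ≤ 1 / (1 - a) := by
  have h1a : 0 < 1 - a := by linarith
  rw [le_div_iff₀ h1a]
  have : (∑ k ∈ Finset.Icc 1 p, a ^ k) * (1 - a) = a - a ^ (p + 1) := by
    induction p with
    | zero => simp
    | succ p ih => rw [Finset.sum_Icc_succ_top (by omega), add_mul, ih]; ring
  rw [this]
  have : 0 < a ^ (p + 1) := by positivity
  linarith

/-- Each row sum over the longer range is `(1 + a) / (1 - a)` minus two boundary terms decaying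
geometrically from the two ends; summed over the rows, each end costs at most `1 / (1 - a) ^ 2`. -/
theorem abs_sum_sum_geom_dist_sub_le {a : ℝ} (ha0 : 0 < a) (ha1 : a < 1) {p q : ℕ} :
    |∑ k ∈ Finset.Icc 1 p, ∑ l ∈ Finset.Icc 1 q, a ^ Nat.dist k l
      - (1 + a) / (1 - a) * (min p q : ℕ)| ≤ 2 / (1 - a) ^ 2 := by
  wlog hpq : p ≤ q generalizing p q
  · rw [Finset.sum_comm, min_comm]
    simpa only [Nat.dist_comm] using this (p := q) (q := p) (le_of_not_ge hpq)
  have h1a : 0 < 1 - a := by linarith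
  rw [min_eq_left hpq]
  have e : ∑ k ∈ Finset.Icc 1 p, ∑ l ∈ Finset.Icc 1 q, a ^ Nat.dist k l
      - (1 + a) / (1 - a) * p
      = -((∑ k ∈ Finset.Icc 1 p, a ^ k + ∑ k ∈ Finset.Icc 1 p, a ^ (q + 1 - k)) / (1 - a)) := by
    have : ∀ k ∈ Finset.Icc 1 p, ∑ l ∈ Finset.Icc 1 q, a ^ Nat.dist k l
        = (1 + a) / (1 - a) - (a ^ k + a ^ (q + 1 - k)) / (1 - a) := by
      intro k hk
      have hk := Finset.mem_Icc.1 hk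
      rw [← sub_div, eq_div_iff h1a.ne', sum_geom_dist_Icc (hk.2.trans hpq)]
      ring
    rw [Finset.sum_congr rfl this, Finset.sum_sub_distrib, Finset.sum_const, ← Finset.sum_div,
      Finset.sum_add_distrib, Nat.card_Icc]
    simp
    ring
  have h2 : ∑ k ∈ Finset.Icc 1 p, a ^ (q + 1 - k) ≤ 1 / (1 - a) := by
    refine le_trans ?_ (sum_pow_Icc_le ha0 ha1 p)
    calc ∑ k ∈ Finset.Icc 1 p, a ^ (q + 1 - k) ≤ ∑ k ∈ Finset.Icc 1 p, a ^ (p + 1 - k) := by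
          refine Finset.sum_le_sum fun k hk => ?_
          exact pow_le_pow_of_le_one ha0.le ha1.le (by omega)
      _ = ∑ k ∈ Finset.Icc 1 p, a ^ k := by
          refine Finset.sum_nbij' (fun k => p + 1 - k) (fun k => p + 1 - k) ?_ ?_ ?_ ?_ ?_ <;>
            intro k hk <;> simp only [Finset.mem_Icc] at hk ⊢ <;> omega
  have h0 : ∀ f : ℕ → ℕ, 0 ≤ ∑ k ∈ Finset.Icc 1 p, a ^ f k := fun f =>
    Finset.sum_nonneg fun k _ => by positivity
  rw [e, abs_neg, abs_of_nonneg (div_nonneg (add_nonneg (h0 _) (h0 _)) h1a.le)]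
  calc _ ≤ (1 / (1 - a) + 1 / (1 - a)) / (1 - a) := by
        gcongr
        exact sum_pow_Icc_le ha0 ha1 p
    _ = _ := by field_simp; ring

theorem abs_geomWeightedSum_le {a U : ℝ} (ha0 : 0 < a) (ha1 : a < 1) {θ : ℕ → ℝ}
    (hθ : ∀ k, |θ k| ≤ U) (m : ℕ) : |geomWeightedSum a θ m| ≤ U / (1 - a) := by
  have h1a : 0 < 1 - a := by linarith
  have hU : 0 ≤ U := (abs_nonneg _).trans (hθ 0)
  induction m with
  | zero => simp only [geomWeightedSum, abs_zero]; positivity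
  | succ m ih =>
    rw [geomWeightedSum]
    calc |θ m + a * geomWeightedSum a θ m| ≤ |θ m| + a * |geomWeightedSum a θ m| := by
          refine (abs_add_le _ _).trans_eq ?_
          rw [abs_mul, abs_of_pos ha0]
      _ ≤ U + a * (U / (1 - a)) := by gcongr; exact hθ m
      _ = U / (1 - a) := by field_simp; ring

/-- The bound is linear in `m` with one power of `1 / (1 - a)`. Multiplied by the stationary
variance `lam / (1 - a)` and divided by `n`, it is dominated by a multiple of `(1 - a)⁻²`, which is
just integrable enough. -/
theorem abs_geomQuadForm_le {a U : ℝ} (ha0 : 0 < a) (ha1 : a < 1) {θ : ℕ → ℝ}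
    (hθ : ∀ k, |θ k| ≤ U) (m : ℕ) : |geomQuadForm a θ m| ≤ m * (2 * U ^ 2 / (1 - a)) := by
  have h1a : 0 < 1 - a := by linarith
  have hU : 0 ≤ U := (abs_nonneg _).trans (hθ 0)
  induction m with
  | zero => simp [geomQuadForm]
  | succ m ih =>
    rw [geomQuadForm_succ]
    have hS := abs_geomWeightedSum_le ha0 ha1 hθ m
    have hm := hθ m
    calc |geomQuadForm a θ m + θ m ^ 2 + 2 * a * θ m * geomWeightedSum a θ m|
        ≤ |geomQuadForm a θ m| + |θ m| ^ 2 + 2 * a * |θ m| * |geomWeightedSum a θ m| := by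
          refine (abs_add_three _ _ _).trans_eq ?_
          simp only [abs_mul, abs_of_pos ha0, abs_pow, abs_two]
      _ ≤ m * (2 * U ^ 2 / (1 - a)) + U ^ 2 + 2 * a * U * (U / (1 - a)) := by gcongr
      _ = m * (2 * U ^ 2 / (1 - a)) + U ^ 2 * (1 + a) / (1 - a) := by field_simp; ring
      _ ≤ m * (2 * U ^ 2 / (1 - a)) + U ^ 2 * 2 / (1 - a) := by gcongr; linarith
      _ = _ := by push_cast; ring

/-- The coefficient of the `k`-th value of a process in the linear combination with coefficients
`u` of its partial sums at the times `⌊n t⌋`. -/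
noncomputable def stepWeight {I : Finset ℝ≥0} (u : I → ℝ) (n k : ℕ) : ℝ :=
  ∑ t : I, u t * if k ∈ Finset.Icc 1 ⌊(n : ℝ) * (t : ℝ≥0)⌋₊ then 1 else 0

/-- A strict upper bound for the times `⌊n t⌋`, `t ∈ I`. -/
noncomputable def stepHorizon (I : Finset ℝ≥0) (n : ℕ) : ℕ :=
  ⌊(n : ℝ) * (∑ t ∈ I, t : ℝ≥0)⌋₊ + 1

theorem floor_lt_stepHorizon {I : Finset ℝ≥0} (n : ℕ) (t : I) :
    ⌊(n : ℝ) * (t : ℝ≥0)⌋₊ < stepHorizon I n := by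
  refine Nat.lt_succ_of_le (Nat.floor_le_floor ?_)
  -- The sum of the times dominates each of them and, unlike a maximum, makes sense for empty `I`.
  have : (t : ℝ≥0) ≤ ∑ t ∈ I, t :=
    Finset.single_le_sum (f := fun t : ℝ≥0 => t) (fun _ _ => zero_le) t.2
  gcongr

theorem stepHorizon_le (I : Finset ℝ≥0) (n : ℕ) :
    (stepHorizon I n : ℝ) ≤ n * (∑ t ∈ I, t : ℝ≥0) + 1 := by
  rw [stepHorizon]
  push_cast
  gcongr
  simpa using Nat.floor_le (a := (n : ℝ) * (∑ t ∈ I, t : ℝ≥0)) (by positivity)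

theorem abs_stepWeight_le {I : Finset ℝ≥0} (u : I → ℝ) (n k : ℕ) :
    |stepWeight u n k| ≤ ∑ t : I, |u t| := by
  refine (Finset.abs_sum_le_sum_abs _ _).trans (Finset.sum_le_sum fun t _ => ?_)
  split_ifs <;> simp

theorem sum_mul_ite_mem_Icc {p m : ℕ} (h : p < m) (x : ℕ → ℝ) :
    ∑ k ∈ Finset.range m, (if k ∈ Finset.Icc 1 p then 1 else 0) * x k
      = ∑ k ∈ Finset.Icc 1 p, x k := by
  simp only [ite_mul, one_mul, zero_mul]
  rw [← Finset.sum_filter]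
  refine Finset.sum_congr ?_ fun _ _ => rfl
  ext k
  simp only [Finset.mem_filter, Finset.mem_range, Finset.mem_Icc]
  omega

/-- Interchanging the sums puts a linear combination of partial sums into the form of a weighted sum
of single values, to which the generating function applies. -/
theorem sum_mul_partialSum_eq {I : Finset ℝ≥0} (u : I → ℝ) (n : ℕ) (x : ℕ → ℝ) :
    ∑ t : I, u t * ∑ k ∈ Finset.Icc 1 ⌊(n : ℝ) * (t : ℝ≥0)⌋₊, x k
      = ∑ k ∈ Finset.range (stepHorizon I n), stepWeight u n k * x k := by
  simp only [stepWeight, Finset.sum_mul]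
  rw [Finset.sum_comm]
  refine Finset.sum_congr rfl fun t _ => ?_
  rw [← sum_mul_ite_mem_Icc (floor_lt_stepHorizon n t), Finset.mul_sum]
  exact Finset.sum_congr rfl fun k _ => by ring

theorem sum_sum_stepWeight {I : Finset ℝ≥0} (u : I → ℝ) (n : ℕ) (r : ℕ → ℕ → ℝ) :
    ∑ k ∈ Finset.range (stepHorizon I n), ∑ l ∈ Finset.range (stepHorizon I n),
        r k l * (stepWeight u n k * stepWeight u n l)
      = ∑ s : I, ∑ t : I, u s * u t * ∑ k ∈ Finset.Icc 1 ⌊(n : ℝ) * (s : ℝ≥0)⌋₊,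
          ∑ l ∈ Finset.Icc 1 ⌊(n : ℝ) * (t : ℝ≥0)⌋₊, r k l := by
  have h1 : ∀ k, ∑ l ∈ Finset.range (stepHorizon I n),
      r k l * (stepWeight u n k * stepWeight u n l) = stepWeight u n k *
        ∑ t : I, u t * ∑ l ∈ Finset.Icc 1 ⌊(n : ℝ) * (t : ℝ≥0)⌋₊, r k l := by
    intro k
    rw [sum_mul_partialSum_eq, Finset.mul_sum]
    exact Finset.sum_congr rfl fun l _ => by ring
  rw [Finset.sum_congr rfl fun k _ => h1 k, ← sum_mul_partialSum_eq]
  refine Finset.sum_congr rfl fun s _ => ?_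
  rw [Finset.sum_comm, Finset.mul_sum]
  refine Finset.sum_congr rfl fun t _ => ?_
  rw [← Finset.mul_sum]
  ring

/-- The covariance form of a standard Wiener process. -/
noncomputable def wienerForm {I : Finset ℝ≥0} (u : I → ℝ) : ℝ :=
  ∑ s : I, ∑ t : I, u s * u t * (min (s : ℝ≥0) (t : ℝ≥0) : ℝ≥0)

theorem tendsto_natFloor_mul_div (t : ℝ≥0) :
    Tendsto (fun n : ℕ => (⌊(n : ℝ) * t⌋₊ : ℝ) / n) atTop (𝓝 t) := by
  have := (tendsto_nat_floor_mul_div_atTop (R := ℝ) t.2).comp tendsto_natCast_atTop_atTop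
  refine this.congr fun n => ?_
  simp only [Function.comp, mul_comm]
  rfl

/-- Expanded bilinearly in `u`, the form is a combination of double sums over rectangles, each equal
to `(1 + a) / (1 - a) * min ⌊ns⌋ ⌊nt⌋` up to an error bounded in `n`. -/
theorem tendsto_geomQuadForm_stepWeight_div {a : ℝ} (ha0 : 0 < a) (ha1 : a < 1)
    {I : Finset ℝ≥0} (u : I → ℝ) :
    Tendsto (fun n : ℕ => geomQuadForm a (stepWeight u n) (stepHorizon I n) / n) atTop
      (𝓝 ((1 + a) / (1 - a) * wienerForm u)) := by
  have hK : ∀ s t : ℝ≥0, Tendsto (fun n : ℕ => (∑ k ∈ Finset.Icc 1 ⌊(n : ℝ) * s⌋₊,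
      ∑ l ∈ Finset.Icc 1 ⌊(n : ℝ) * t⌋₊, a ^ Nat.dist k l) / n) atTop
      (𝓝 ((1 + a) / (1 - a) * (min s t : ℝ≥0))) := by
    intro s t
    have h1 : Tendsto (fun n : ℕ => (1 + a) / (1 - a) *
        ((min ⌊(n : ℝ) * s⌋₊ ⌊(n : ℝ) * t⌋₊ : ℕ) / n : ℝ)) atTop
        (𝓝 ((1 + a) / (1 - a) * (min s t : ℝ≥0))) := by
      refine Tendsto.const_mul _ ?_
      have := (tendsto_natFloor_mul_div s).min (tendsto_natFloor_mul_div t)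
      rw [NNReal.coe_min]
      refine this.congr fun n => ?_
      rw [Nat.cast_min, min_div_div_right (by positivity)]
    have h2 : Tendsto (fun n : ℕ => 2 / (1 - a) ^ 2 / (n : ℝ)) atTop (𝓝 0) :=
      tendsto_const_div_atTop_nhds_zero_nat _
    have h3 : Tendsto (fun n : ℕ => (∑ k ∈ Finset.Icc 1 ⌊(n : ℝ) * s⌋₊,
        ∑ l ∈ Finset.Icc 1 ⌊(n : ℝ) * t⌋₊, a ^ Nat.dist k l) / n - (1 + a) / (1 - a) *
        ((min ⌊(n : ℝ) * s⌋₊ ⌊(n : ℝ) * t⌋₊ : ℕ) / n : ℝ)) atTop (𝓝 0) := by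
      refine squeeze_zero_norm (fun n => ?_) h2
      rw [Real.norm_eq_abs, mul_div_assoc', ← sub_div, abs_div, Nat.abs_cast]
      gcongr
      exact abs_sum_sum_geom_dist_sub_le ha0 ha1
    simpa using h3.add h1
  have h := tendsto_finsetSum (Finset.univ : Finset I) fun s _ =>
    tendsto_finsetSum (Finset.univ : Finset I) fun t _ => (hK s t).const_mul (u s * u t)
  convert h using 1
  · ext n
    rw [geomQuadForm, sum_sum_stepWeight, Finset.sum_div]
    refine Finset.sum_congr rfl fun s _ => ?_
    rw [Finset.sum_div]
    exact Finset.sum_congr rfl fun t _ => by rw [mul_div_assoc]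
  · congr 1
    rw [wienerForm, Finset.mul_sum]
    refine Finset.sum_congr rfl fun s _ => ?_
    rw [Finset.mul_sum]
    exact Finset.sum_congr rfl fun t _ => by ring

/-! ### Gaussian processes -/

/-- Every sequence of vectors of a real inner product space has the same Gram matrix as the rows of
a lower triangular matrix. -/
theorem exists_lowerTriangular_of_inner {H : Type*} [NormedAddCommGroup H] [InnerProductSpace ℝ H]
    (v : ℕ → H) : ∃ L : ℕ → ℕ → ℝ, (∀ k i, k < i → L k i = 0) ∧
      ∀ m k l, k < m → l < m → ∑ i ∈ Finset.range m, L k i * L l i = inner ℝ (v k) (v l) := by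
  -- The entries are coordinates in the Gram–Schmidt system: `v k` lies in the span of the first `k
  -- + 1` vectors, which gives triangularity, and Parseval gives the Gram matrix.
  set e := InnerProductSpace.gramSchmidtNormed ℝ v with he
  refine ⟨fun k i => inner ℝ (e i) (v k), fun k i hki => ?_, fun m k l hk hl => ?_⟩
  · simp only [he, InnerProductSpace.gramSchmidtNormed, inner_smul_left,
      InnerProductSpace.gramSchmidt_inv_triangular ℝ v hki, mul_zero]
  · have horth : ∀ i j, i ≠ j → inner ℝ (e i) (e j) = 0 := by
      intro i j hij
      simp only [he, InnerProductSpace.gramSchmidtNormed, inner_smul_left, inner_smul_right,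
        InnerProductSpace.gramSchmidt_orthogonal ℝ v hij, mul_zero]
    -- Linear independence is not assumed, so `e i` may vanish. It is either zero or a unit vector,
    -- and this identity, all the expansion needs, holds in both cases.
    have hunit : ∀ i, (inner ℝ (e i) (e i)) • e i = e i := by
      intro i
      by_cases hi : e i = 0
      · simp [hi]
      · rw [real_inner_self_eq_norm_sq, InnerProductSpace.gramSchmidtNormed_unit_length' hi]
        simp
    have hspan : ∀ x ∈ Submodule.span ℝ (e '' Set.Iio m),
        ∑ i ∈ Finset.range m, (inner ℝ (e i) x) • e i = x := by
      intro x hx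
      induction hx using Submodule.span_induction with
      | mem x hx =>
        obtain ⟨j, hj, rfl⟩ := hx
        rw [Finset.sum_eq_single j, hunit]
        · intro i _ hij
          rw [horth i j hij, zero_smul]
        · intro h
          exact absurd (Finset.mem_range.2 hj) h
      | zero => simp
      | add x y _ _ hx hy => simp only [inner_add_right, add_smul, Finset.sum_add_distrib, hx, hy]
      | smul c x _ hx =>
        simp only [inner_smul_right, mul_smul]
        rw [← Finset.smul_sum, hx]
    have hmem : v k ∈ Submodule.span ℝ (e '' Set.Iio m) := by
      rw [he, InnerProductSpace.span_gramSchmidtNormed, InnerProductSpace.span_gramSchmidt_Iio]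
      exact Submodule.subset_span ⟨k, hk, rfl⟩
    conv_rhs => rw [← hspan _ hmem]
    rw [sum_inner]
    refine Finset.sum_congr rfl fun i _ => ?_
    rw [inner_smul_left]
    rfl

/-- The coefficients of the moving average representation of a stationary autoregressive sequence
with covariances `lam / (1 - a) * a ^ |k - l|`. -/
noncomputable def arCoeff (lam a : ℝ) : ℕ → ℕ → ℝ
  | 0, i => if i = 0 then √(lam / (1 - a)) else 0
  | k + 1, i => if i = k + 1 then √(lam * (1 + a)) else a * arCoeff lam a k i

theorem arCoeff_eq_zero (lam a : ℝ) {k i : ℕ} (h : k < i) : arCoeff lam a k i = 0 := by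
  induction k with
  | zero => simp [arCoeff, h.ne']
  | succ k ih => rw [arCoeff, if_neg h.ne', ih (by omega), mul_zero]

theorem sum_arCoeff_mul_arCoeff {lam a : ℝ} (hlam : 0 < lam) (ha0 : 0 < a) (ha1 : a < 1)
    {m k l : ℕ} (hk : k < m) (hl : l < m) :
    ∑ i ∈ Finset.range m, arCoeff lam a k i * arCoeff lam a l i
      = lam / (1 - a) * a ^ Nat.dist k l := by
  have h1a : 0 < 1 - a := by linarith
  wlog hkl : k ≤ l generalizing k l
  · rw [Nat.dist_comm, ← this hl hk (le_of_not_ge hkl)]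
    exact Finset.sum_congr rfl fun i _ => mul_comm _ _
  have hdiag : ∀ k < m, ∑ i ∈ Finset.range m, arCoeff lam a k i * arCoeff lam a k i
      = lam / (1 - a) := by
    intro k hk
    induction k with
    | zero =>
      rw [Finset.sum_eq_single 0]
      · simp only [arCoeff, if_true]
        exact Real.mul_self_sqrt (by positivity)
      · intro i _ hi
        simp [arCoeff, hi]
      · intro h
        exact absurd (Finset.mem_range.2 hk) h
    | succ k ih =>
      -- The innovation variance `lam (1 + a)` equals `(1 - a²) * lam / (1 - a)`, exactly what the
      -- contraction by `a²` loses.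
      have e : ∀ i, arCoeff lam a (k + 1) i * arCoeff lam a (k + 1) i
          = a ^ 2 * (arCoeff lam a k i * arCoeff lam a k i)
            + if i = k + 1 then lam * (1 + a) else 0 := by
        intro i
        simp only [arCoeff]
        split_ifs with h
        · rw [h, arCoeff_eq_zero lam a k.lt_succ_self, Real.mul_self_sqrt (by positivity)]
          ring
        · ring
      simp only [e]
      rw [Finset.sum_add_distrib, ← Finset.mul_sum, ih (by omega), Finset.sum_ite_eq',
        if_pos (Finset.mem_range.2 hk)]
      field_simp
      ring
  induction l, hkl using Nat.le_induction with
  | base => simp [hdiag k hk]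
  | succ l hkl ih =>
    -- The innovation at `l + 1` is absent from row `k`, so the covariance merely acquires a factor
    -- `a`.
    have e : ∀ i, arCoeff lam a k i * arCoeff lam a (l + 1) i
        = a * (arCoeff lam a k i * arCoeff lam a l i) := by
      intro i
      rw [arCoeff]
      split_ifs with h
      · rw [h, arCoeff_eq_zero lam a (show k < l + 1 by omega)]
        ring
      · ring
    have hd : Nat.dist k (l + 1) = Nat.dist k l + 1 := by simp only [Nat.dist]; omega
    simp only [e]
    rw [← Finset.mul_sum, ih (by omega), hd]
    ring

theorem measurable_arCoeff (lam : ℝ) (k i : ℕ) : Measurable (fun a => arCoeff lam a k i) := by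
  induction k with
  | zero => simp only [arCoeff]; split_ifs <;> fun_prop
  | succ k ih => simp only [arCoeff]; split_ifs <;> fun_prop

/-! ### A triangular square root of the covariances averaged over the thinning parameter. -/

section MixedCovariance

variable {Ω : Type*} [MeasurableSpace Ω] {μ : Measure Ω} [IsProbabilityMeasure μ] {lam : ℝ}
  {a : Ω → ℝ}

/-- The only unbounded source is the initial coefficient, whose square is `lam / (1 - a)`; later
rows multiply by `a < 1` or insert a bounded entry. -/
theorem memLp_arCoeff (hlam : 0 < lam) (ham : Measurable a)
    (ha : ∀ᵐ ω ∂μ, a ω ∈ Set.Ioo (0 : ℝ) 1) (hint : Integrable (fun ω => 1 / (1 - a ω)) μ)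
    (k i : ℕ) : MemLp (fun ω => arCoeff lam (a ω) k i) 2 μ := by
  have hm : ∀ k i, AEStronglyMeasurable (fun ω => arCoeff lam (a ω) k i) μ := fun k i =>
    ((measurable_arCoeff lam k i).comp ham).aestronglyMeasurable
  induction k with
  | zero =>
    by_cases hi : i = 0
    · rw [memLp_two_iff_integrable_sq (hm 0 i)]
      refine (hint.const_mul lam).congr ?_
      filter_upwards [ha] with ω hω
      have : 0 < 1 - a ω := by linarith [hω.2]
      simp only [arCoeff, hi, if_true]
      rw [Real.sq_sqrt (by positivity)]
      ring
    · simp [arCoeff, hi]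
  | succ k ih =>
    by_cases hi : i = k + 1
    · refine MemLp.of_bound (hm _ _) (√(lam * 2)) ?_
      filter_upwards [ha] with ω hω
      simp only [arCoeff, hi, if_true]
      rw [Real.norm_of_nonneg (Real.sqrt_nonneg _)]
      exact Real.sqrt_le_sqrt (by nlinarith [hω.2])
    · refine ih.mono (hm _ _) ?_
      filter_upwards [ha] with ω hω
      simp only [arCoeff, hi, if_false]
      rw [norm_mul, Real.norm_of_nonneg hω.1.le]
      exact mul_le_of_le_one_left (norm_nonneg _) hω.2.le

/-- The averaged covariances of the stationary INAR(1) process have a triangular square root. -/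
theorem exists_lowerTriangular_mixedCovariance (hlam : 0 < lam) (ham : Measurable a)
    (ha : ∀ᵐ ω ∂μ, a ω ∈ Set.Ioo (0 : ℝ) 1) (hint : Integrable (fun ω => 1 / (1 - a ω)) μ) :
    ∃ L : ℕ → ℕ → ℝ, (∀ k i, k < i → L k i = 0) ∧
      ∀ m k l, k < m → l < m → ∑ i ∈ Finset.range m, L k i * L l i
        = ∫ ω, lam / (1 - a ω) * a ω ^ Nat.dist k l ∂μ := by
  have hmem := memLp_arCoeff hlam ham ha hint
  -- Regarding the random coefficients as vectors in `ℓ²` with values in `L²(μ)` turns the averaged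
  -- covariance into a Gram matrix, to which Gram–Schmidt applies.
  let c : ℕ → ℕ → Lp ℝ 2 μ := fun k i => (hmem k i).toLp
  let v : ℕ → lp (fun _ : ℕ => Lp ℝ 2 μ) 2 := fun k =>
    ∑ i ∈ Finset.range (k + 1), lp.single 2 i (c k i)
  have hc0 : ∀ k i, k < i → c k i = 0 := by
    intro k i h
    have : (fun ω => arCoeff lam (a ω) k i) = 0 := by
      ext ω
      exact arCoeff_eq_zero lam (a ω) h
    simp only [c, this]
    exact MemLp.toLp_zero _
  have hv : ∀ k i, (v k : ∀ _ : ℕ, Lp ℝ 2 μ) i = c k i := by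
    intro k i
    simp only [v, lp.coeFn_sum, Finset.sum_apply, lp.single_apply, Pi.single_apply]
    rw [Finset.sum_ite_eq]
    split_ifs with h
    · rfl
    · rw [hc0 k i (by simpa using h)]
  have hinner : ∀ m k l, k < m → inner ℝ (v k) (v l)
      = ∑ i ∈ Finset.range m, inner ℝ (c k i) (c l i) := by
    intro m k l hk
    have h1 : inner ℝ (v k) (v l) = ∑ i ∈ Finset.range (k + 1), inner ℝ (c k i) (c l i) := by
      conv_lhs => rw [show v k = ∑ i ∈ Finset.range (k + 1), lp.single 2 i (c k i) from rfl]
      rw [sum_inner]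
      exact Finset.sum_congr rfl fun i _ => by rw [lp.inner_single_left, hv]
    rw [h1]
    refine Finset.sum_subset (Finset.range_subset_range.2 hk) fun i _ hi => ?_
    rw [hc0 k i (by simpa using hi), inner_zero_left]
  obtain ⟨L, hL0, hL⟩ := exists_lowerTriangular_of_inner v
  refine ⟨L, hL0, fun m k l hk hl => ?_⟩
  rw [hL m k l hk hl, hinner m k l hk]
  have h2 : ∀ i, inner ℝ (c k i) (c l i)
      = ∫ ω, arCoeff lam (a ω) k i * arCoeff lam (a ω) l i ∂μ := by
    intro i
    rw [L2.inner_def]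
    refine integral_congr_ae ?_
    filter_upwards [(hmem k i).coeFn_toLp, (hmem l i).coeFn_toLp] with ω h1 h2
    simp only [c, h1, h2]
    simp [mul_comm]
  simp only [h2]
  have h3 : ∀ i, Integrable (fun ω => arCoeff lam (a ω) k i * arCoeff lam (a ω) l i) μ :=
    fun i => (hmem k i).integrable_mul (hmem l i)
  rw [← integral_finsetSum _ fun i _ => h3 i]
  refine integral_congr_ae ?_
  filter_upwards [ha] with ω hω
  exact sum_arCoeff_mul_arCoeff hlam hω.1 hω.2 hk hl

end MixedCovariance

/-! ### Characteristic functions of Gaussian white noise and of the Wiener process. -/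

theorem integral_exp_I_mul_gaussianReal (c : ℝ) (v : ℝ≥0) :
    ∫ x, Complex.exp (Complex.I * ((c * x : ℝ) : ℂ)) ∂(gaussianReal 0 v)
      = Complex.exp (((-(v * c ^ 2 / 2) : ℝ)) : ℂ) := by
  have h := charFun_gaussianReal (μ := 0) (v := v) c
  rw [charFun_apply_real] at h
  convert h using 2
  · ext x
    congr 1
    push_cast
    ring
  · push_cast
    ring

theorem integral_exp_sum_infinitePi_gaussianReal (c : ℕ → ℝ) (m : ℕ) :
    ∫ x, Complex.exp (Complex.I * ((∑ i ∈ Finset.range m, c i * x i : ℝ) : ℂ))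
        ∂(Measure.infinitePi fun _ : ℕ => gaussianReal 0 1)
      = Complex.exp (((-(∑ i ∈ Finset.range m, c i ^ 2) / 2 : ℝ)) : ℂ) := by
  have hI := iIndepFun_infinitePi (P := fun _ : ℕ => gaussianReal 0 1)
    (X := fun _ (x : ℝ) => x) fun _ => measurable_id
  have h := (hI.precomp (g := fun i : Fin m => (i : ℕ)) Fin.val_injective).integral_fun_prod_comp
    (f := fun (i : Fin m) (x : ℝ) => Complex.exp (Complex.I * ((c i * x : ℝ) : ℂ)))
    (fun i => (measurable_pi_apply _).aemeasurable) (fun i => by fun_prop)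
  have h1 : ∀ i : Fin m, ∫ x, Complex.exp (Complex.I * ((c i * x (i : ℕ) : ℝ) : ℂ))
      ∂(Measure.infinitePi fun _ : ℕ => gaussianReal 0 1)
      = Complex.exp (((-(c i ^ 2 / 2) : ℝ)) : ℂ) := by
    intro i
    have hm : Measurable (fun x : ℕ → ℝ => x i) := measurable_pi_apply _
    have h2 := integral_map (μ := Measure.infinitePi fun _ : ℕ => gaussianReal 0 1)
      hm.aemeasurable (f := fun x : ℝ => Complex.exp (Complex.I * ((c i * x : ℝ) : ℂ))) (by fun_prop)
    rw [← h2, Measure.infinitePi_map_eval, integral_exp_I_mul_gaussianReal]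
    simp
  simp only [h1, ← Complex.exp_sum] at h
  have e1 : ∀ x : ℕ → ℝ, Complex.I * ((∑ i ∈ Finset.range m, c i * x i : ℝ) : ℂ)
      = ∑ i : Fin m, Complex.I * ((c i * x i : ℝ) : ℂ) := by
    intro x
    rw [Finset.sum_range, Complex.ofReal_sum, Finset.mul_sum]
  have e2 : (((-(∑ i ∈ Finset.range m, c i ^ 2) / 2 : ℝ)) : ℂ)
      = ∑ i : Fin m, (((-(c i ^ 2 / 2) : ℝ)) : ℂ) := by
    rw [Finset.sum_range, ← Complex.ofReal_sum, neg_div, Finset.sum_div, Finset.sum_neg_distrib]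
  simp only [e1, e2]
  exact h

section PreBrownian

variable {Ω' : Type*} [MeasurableSpace Ω'] {ν : Measure Ω'} {B : ℝ≥0 → Ω' → ℝ}

/-- The variance follows bilinearly from the covariances `min s t`. Being a variance, `wienerForm u`
is nonnegative, so `toNNReal` loses nothing. -/
theorem ProbabilityTheory.IsPreBrownianReal.map_sum_mul (hB : IsPreBrownianReal B ν)
    {I : Finset ℝ≥0} (u : I → ℝ) :
    ν.map (fun ω => ∑ t : I, u t * B t ω) = gaussianReal 0 (wienerForm u).toNNReal ∧
      0 ≤ wienerForm u := by
  have hP := hB.isGaussianProcess.isProbabilityMeasure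
  have hmem : ∀ t, MemLp (B t) 2 ν := fun t =>
    (hB.isGaussianProcess.hasGaussianLaw_eval t).memLp_two
  let L : (I → ℝ) →L[ℝ] ℝ := ∑ t : I, u t • ContinuousLinearMap.proj (R := ℝ) t
  have hG : HasGaussianLaw (fun ω => ∑ t : I, u t * B t ω) ν := by
    have h := (hB.isGaussianProcess.hasGaussianLaw I).map L
    have e : (fun ω => ∑ t : I, u t * B t ω) = L ∘ fun ω => I.restrict (B · ω) := by
      ext ω
      simp [L]
    rw [e]
    exact h
  have hmean : ∫ ω, ∑ t : I, u t * B t ω ∂ν = 0 := by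
    rw [integral_finsetSum _ fun (t : I) _ => (hB.integrable_eval t).const_mul (u t)]
    refine Finset.sum_eq_zero fun t _ => ?_
    rw [integral_const_mul, hB.integral_eval, mul_zero]
  have hvar : Var[fun ω => ∑ t : I, u t * B t ω; ν] = wienerForm u := by
    rw [← covariance_self hG.aemeasurable, covariance_fun_sum_fun_sum
      (fun t : I => (hmem t).const_mul (u t)) (fun t : I => (hmem t).const_mul (u t)), wienerForm]
    refine Finset.sum_congr rfl fun s _ => Finset.sum_congr rfl fun t _ => ?_
    rw [covariance_const_mul_left, covariance_const_mul_right, hB.covariance_fun_eval]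
    ring
  have hlaw := hG.map_eq_gaussianReal
  rw [hmean, hvar] at hlaw
  exact ⟨hlaw, hvar ▸ variance_nonneg _ _⟩

theorem ProbabilityTheory.IsPreBrownianReal.integral_exp_sum (hB : IsPreBrownianReal B ν)
    {I : Finset ℝ≥0} (u : I → ℝ) (c : ℝ) :
    ∫ ω, Complex.exp (Complex.I * ((∑ t : I, u t * (c * B t ω) : ℝ) : ℂ)) ∂ν
      = Complex.exp (((-(c ^ 2 * wienerForm u) / 2 : ℝ)) : ℂ) := by
  obtain ⟨hlaw, hnn⟩ := hB.map_sum_mul u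
  have hm : AEMeasurable (fun ω => ∑ t : I, u t * B t ω) ν :=
    Finset.aemeasurable_fun_sum _ fun t _ => (hB.aemeasurable t).const_mul _
  have h2 := integral_map (μ := ν) hm
      (f := fun x : ℝ => Complex.exp (Complex.I * ((c * x : ℝ) : ℂ))) (by fun_prop)
  rw [hlaw, integral_exp_I_mul_gaussianReal, Real.coe_toNNReal _ hnn] at h2
  convert h2.symm using 2
  · ext ω
    congr 3
    rw [Finset.mul_sum]
    exact Finset.sum_congr rfl fun t _ => by ring
  · congr 1
    ring

end PreBrownian

/-! ### Integrability with respect to the mixing distribution -/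

/-- Near 1 the function `ψ` is below a constant and `(1 - x) ^ (β - 2)` is integrable because `β - 2
> -1`. Away from 1, `(1 - x)⁻²` is bounded and the finite mass of `ρ` replaces any bound on `ψ`. -/
theorem lintegral_inv_sq_lt_top {β : ℝ} (hβ : 1 < β) {ψ : ℝ → ℝ} {ψ₁ : ℝ}
    (hψ_meas : AEMeasurable ψ (volume.restrict (Set.Ioo (0 : ℝ) 1)))
    (hψ_lim : Tendsto ψ (𝓝[<] (1 : ℝ)) (𝓝 ψ₁))
    {ρ : Measure ℝ} [IsFiniteMeasure ρ]
    (hρ : ρ = (volume.restrict (Set.Ioo (0 : ℝ) 1)).withDensity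
        (fun x => ENNReal.ofReal (ψ x * (1 - x) ^ β))) :
    ∫⁻ x, ENNReal.ofReal (1 / (1 - x) ^ 2) ∂ρ < ∞ := by
  set M : ℝ := |ψ₁| + 1
  have hM : 0 < M := by positivity
  obtain ⟨c, hc1, hc⟩ : ∃ c < (1 : ℝ), ∀ x ∈ Set.Ioo c 1, ψ x < M := by
    have h : ∀ᶠ x in 𝓝[<] (1 : ℝ), ψ x < M :=
      hψ_lim.eventually (gt_mem_nhds (by have := le_abs_self ψ₁; simp only [M]; linarith))
    exact (mem_nhdsLT_iff_exists_Ioo_subset.1 h)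
  have hdens : AEMeasurable (fun x => ENNReal.ofReal (ψ x * (1 - x) ^ β))
      (volume.restrict (Set.Ioo (0 : ℝ) 1)) :=
    (hψ_meas.mul (by fun_prop)).ennreal_ofReal
  have hf : Measurable (fun x : ℝ => ENNReal.ofReal (1 / (1 - x) ^ 2)) := by fun_prop
  have hmass : ∫⁻ x in Set.Ioo (0 : ℝ) 1, ENNReal.ofReal (ψ x * (1 - x) ^ β) < ∞ := by
    have := measure_lt_top ρ Set.univ
    rwa [hρ, withDensity_apply _ MeasurableSet.univ, Measure.restrict_univ] at this
  have hpow : ∫⁻ x in Set.Ioo (0 : ℝ) 1, ENNReal.ofReal (M * (1 - x) ^ (β - 2)) < ∞ := by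
    have h1 : IntervalIntegrable (fun x : ℝ => x ^ (β - 2)) volume 1 0 :=
      intervalIntegral.intervalIntegrable_rpow' (by linarith)
    have h2 := h1.comp_sub_left 1
    rw [sub_self, sub_zero, intervalIntegrable_iff_integrableOn_Ioo_of_le zero_le_one] at h2
    exact (h2.const_mul M).lintegral_lt_top
  rw [hρ, lintegral_withDensity_eq_lintegral_mul₀ hdens hf.aemeasurable]
  have hbound : ∀ x ∈ Set.Ioo (0 : ℝ) 1,
      ((fun x => ENNReal.ofReal (ψ x * (1 - x) ^ β)) * fun x => ENNReal.ofReal (1 / (1 - x) ^ 2)) x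
        ≤ ENNReal.ofReal (1 / (1 - c) ^ 2) * ENNReal.ofReal (ψ x * (1 - x) ^ β)
          + ENNReal.ofReal (M * (1 - x) ^ (β - 2)) := by
    intro x hx
    have h1x : 0 < 1 - x := by linarith [hx.2]
    simp only [Pi.mul_apply]
    by_cases hxc : x ≤ c
    · refine le_trans ?_ le_self_add
      rw [mul_comm]
      have : 0 < 1 - c := by linarith
      gcongr
    · refine le_trans ?_ le_add_self
      rw [← ENNReal.ofReal_mul' (by positivity)]
      refine ENNReal.ofReal_le_ofReal ?_
      have h2 : (1 - x) ^ β * (1 / (1 - x) ^ 2) = (1 - x) ^ (β - 2) := by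
        rw [Real.rpow_sub h1x, Real.rpow_two]; ring
      rw [mul_assoc, h2]
      have := hc x ⟨not_le.1 hxc, hx.2⟩
      gcongr
  calc _ ≤ ∫⁻ x in Set.Ioo (0 : ℝ) 1, (ENNReal.ofReal (1 / (1 - c) ^ 2)
          * ENNReal.ofReal (ψ x * (1 - x) ^ β) + ENNReal.ofReal (M * (1 - x) ^ (β - 2))) :=
        setLIntegral_mono_ae' measurableSet_Ioo (ae_of_all _ hbound)
    _ = ENNReal.ofReal (1 / (1 - c) ^ 2) * (∫⁻ x in Set.Ioo (0 : ℝ) 1,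
          ENNReal.ofReal (ψ x * (1 - x) ^ β))
        + ∫⁻ x in Set.Ioo (0 : ℝ) 1, ENNReal.ofReal (M * (1 - x) ^ (β - 2)) := by
        rw [lintegral_add_right _ (by fun_prop), lintegral_const_mul' _ _ ENNReal.ofReal_ne_top]
    _ < ∞ := ENNReal.add_lt_top.2 ⟨ENNReal.mul_lt_top ENNReal.ofReal_lt_top hmass, hpow⟩

/-! ### Limits of the characteristic functions -/

section Limits

variable {Ω : Type*} [MeasurableSpace Ω] {μ : Measure Ω} {lam : ℝ} {a : Ω → ℝ}

theorem integrable_div_one_sub_of_sq (ham : Measurable a)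
    (ha : ∀ᵐ ω ∂μ, a ω ∈ Set.Ioo (0 : ℝ) 1) (hint : Integrable (fun ω => 1 / (1 - a ω) ^ 2) μ) :
    Integrable (fun ω => 1 / (1 - a ω)) μ := by
  refine hint.mono
    (by fun_prop : Measurable fun ω => 1 / (1 - a ω)).aestronglyMeasurable ?_
  filter_upwards [ha] with ω hω
  have h1 : 0 < 1 - a ω := by linarith [hω.2]
  rw [Real.norm_of_nonneg (by positivity), Real.norm_of_nonneg (by positivity)]
  exact one_div_le_one_div_of_le (by positivity) (by nlinarith [hω.1])

theorem integrable_one_add_div_sq (ham : Measurable a)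
    (ha : ∀ᵐ ω ∂μ, a ω ∈ Set.Ioo (0 : ℝ) 1) (hint : Integrable (fun ω => 1 / (1 - a ω) ^ 2) μ) :
    Integrable (fun ω => (1 + a ω) / (1 - a ω) ^ 2) μ := by
  refine (hint.const_mul 2).mono
    (by fun_prop : Measurable fun ω => (1 + a ω) / (1 - a ω) ^ 2).aestronglyMeasurable ?_
  filter_upwards [ha] with ω hω
  have h1 : 0 < 1 - a ω := by linarith [hω.2]
  have h0 := hω.1
  rw [Real.norm_of_nonneg (by positivity), Real.norm_of_nonneg (by positivity), mul_one_div]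
  gcongr
  linarith [hω.2]

theorem measurable_geomQuadForm (θ : ℕ → ℝ) (m : ℕ) :
    Measurable (fun a => geomQuadForm a θ m) := by
  unfold geomQuadForm
  fun_prop

/-- This includes `N = 0`, where both sides are 0 by the conventions for powers and inverses. -/
theorem natCast_rpow_neg_half_sq (N : ℕ) : ((N : ℝ) ^ (-(1 / 2) : ℝ)) ^ 2 = (N : ℝ)⁻¹ := by
  rw [← Real.rpow_natCast, ← Real.rpow_mul (by positivity)]
  norm_num [Real.rpow_neg_one]

theorem tendsto_natCast_rpow_neg_half :
    Tendsto (fun N : ℕ => (N : ℝ) ^ (-(1 / 2) : ℝ)) atTop (𝓝 0) :=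
  (tendsto_rpow_neg_atTop (by norm_num : (0 : ℝ) < 1 / 2)).comp tendsto_natCast_atTop_atTop

/-- The pointwise limit for the aggregation of independent copies. -/
theorem tendsto_natCast_mul_inarLogChar {lam a U : ℝ} (hlam : 0 < lam) (ha0 : 0 < a) (ha1 : a < 1)
    {θ : ℕ → ℝ} (hθ : ∀ k, |θ k| ≤ U) (m : ℕ) :
    Tendsto (fun N : ℕ => (N : ℂ) * inarLogChar lam a (fun k => (N : ℝ) ^ (-(1 / 2) : ℝ) * θ k) m)
      atTop (𝓝 ((-(lam / (2 * (1 - a)) * geomQuadForm a θ m) : ℝ) : ℂ)) := by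
  have hU : 0 ≤ U := (abs_nonneg _).trans (hθ 0)
  have h1a : 0 < 1 - a := by linarith
  have hr := tendsto_natCast_rpow_neg_half
  have hb : Tendsto (fun N : ℕ => lam * (m + 1 / (1 - a)) * (3 * U ^ 3 / (1 - a) ^ 3)
      * (N : ℝ) ^ (-(1 / 2) : ℝ)) atTop (𝓝 0) := by
    simpa using hr.const_mul (lam * (m + 1 / (1 - a)) * (3 * U ^ 3 / (1 - a) ^ 3))
  have hsmall : ∀ᶠ N : ℕ in atTop, (N : ℝ) ^ (-(1 / 2) : ℝ) * U ≤ 1 := by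
    have h : Tendsto (fun N : ℕ => (N : ℝ) ^ (-(1 / 2) : ℝ) * U) atTop (𝓝 0) := by
      simpa using hr.mul_const U
    exact h.eventually (ge_mem_nhds one_pos)
  rw [tendsto_iff_norm_sub_tendsto_zero]
  refine squeeze_zero' (Eventually.of_forall fun _ => norm_nonneg _) ?_ hb
  filter_upwards [hsmall, eventually_ne_atTop 0] with N hN hN0
  have hNr : (N : ℝ) ≠ 0 := by exact_mod_cast hN0
  have hNc : (N : ℂ) ≠ 0 := by exact_mod_cast hN0
  set r := (N : ℝ) ^ (-(1 / 2) : ℝ) with hrdef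
  have hr0 : 0 ≤ r := by positivity
  have hr2 : r ^ 2 = (N : ℝ)⁻¹ := natCast_rpow_neg_half_sq N
  -- With `ε = r U` and `r² = 1 / N`, the cubic error times `N` is a constant times `r`, which
  -- vanishes.
  have h := norm_inarLogChar_add_le hlam ha0 ha1 hN (θ := fun k => r * θ k) (fun k => by
    rw [abs_mul, abs_of_nonneg hr0]
    exact mul_le_mul_of_nonneg_left (hθ k) hr0) m
  rw [geomQuadForm_const_mul, hr2] at h
  have e : (N : ℂ) * inarLogChar lam a (fun k => r * θ k) m
      - ((-(lam / (2 * (1 - a)) * geomQuadForm a θ m) : ℝ) : ℂ)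
      = N * (inarLogChar lam a (fun k => r * θ k) m
        + ((lam / (2 * (1 - a)) * ((N : ℝ)⁻¹ * geomQuadForm a θ m) : ℝ) : ℂ)) := by
    push_cast
    field_simp
    ring
  rw [e, norm_mul, Complex.norm_natCast]
  calc (N : ℝ) * _ ≤ N * (lam * (m + 1 / (1 - a)) * (3 * (r * U) ^ 3 / (1 - a) ^ 3)) := by gcongr
    _ = (N * r ^ 2) * (lam * (m + 1 / (1 - a)) * (3 * U ^ 3 / (1 - a) ^ 3) * r) := by ring
    _ = _ := by rw [hr2, mul_inv_cancel₀ hNr, one_mul]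

/-- The limit for a fixed time horizon and a growing number of copies. -/
theorem tendsto_integral_exp_inarLogChar_pow [IsProbabilityMeasure μ]
    (hlam : 0 < lam) (ham : Measurable a)
    (ha : ∀ᵐ ω ∂μ, a ω ∈ Set.Ioo (0 : ℝ) 1) (hint : Integrable (fun ω => 1 / (1 - a ω)) μ)
    {U : ℝ} {θ : ℕ → ℝ} (hθ : ∀ k, |θ k| ≤ U) (m : ℕ) :
    Tendsto (fun N : ℕ => (∫ ω, Complex.exp
      (inarLogChar lam (a ω) (fun k => (N : ℝ) ^ (-(1 / 2) : ℝ) * θ k) m) ∂μ) ^ N) atTop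
      (𝓝 (Complex.exp (((-(∫ ω, lam / (1 - a ω) * geomQuadForm (a ω) θ m ∂μ) / 2 : ℝ)) : ℂ))) := by
  have hU : 0 ≤ U := (abs_nonneg _).trans (hθ 0)
  refine tendsto_pow_of_tendsto_natCast_mul_sub_one ?_
  have hmeas : ∀ N : ℕ, Measurable (fun ω => Complex.exp
      (inarLogChar lam (a ω) (fun k => (N : ℝ) ^ (-(1 / 2) : ℝ) * θ k) m)) := fun N =>
    ((measurable_inarLogChar lam _ m).comp ham).cexp
  have hI : ∀ N : ℕ, Integrable (fun ω => Complex.exp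
      (inarLogChar lam (a ω) (fun k => (N : ℝ) ^ (-(1 / 2) : ℝ) * θ k) m)) μ := by
    intro N
    refine Integrable.of_bound (hmeas N).aestronglyMeasurable 1 ?_
    filter_upwards [ha] with ω hω
    exact norm_exp_inarLogChar_le hlam hω.1 hω.2 _ m
  have hlim : Tendsto (fun N : ℕ => ∫ ω, (N : ℂ) * (Complex.exp
      (inarLogChar lam (a ω) (fun k => (N : ℝ) ^ (-(1 / 2) : ℝ) * θ k) m) - 1) ∂μ) atTop
      (𝓝 (∫ ω, ((-(lam / (2 * (1 - a ω)) * geomQuadForm (a ω) θ m) : ℝ) : ℂ) ∂μ)) := by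
    -- The dominating function comes from the first-order bound, where `N r² = 1` cancels the
    -- prefactor `N`; the second-order expansion gives only the pointwise limit.
    refine tendsto_integral_filter_of_dominated_convergence
      (fun ω => 2 * (lam * (m + 1 / (1 - a ω)) * (m ^ 2 * U ^ 2))) ?_ ?_ ?_ ?_
    · exact Eventually.of_forall fun N =>
        (((hmeas N).sub_const 1).const_mul _).aestronglyMeasurable
    · have hsmall : ∀ᶠ N : ℕ in atTop, (N : ℝ) ^ (-(1 / 2) : ℝ) * U ≤ 1 := by
        have h : Tendsto (fun N : ℕ => (N : ℝ) ^ (-(1 / 2) : ℝ) * U) atTop (𝓝 0) := by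
          simpa using tendsto_natCast_rpow_neg_half.mul_const U
        exact h.eventually (ge_mem_nhds one_pos)
      filter_upwards [hsmall, eventually_ne_atTop 0] with N hN hN0
      filter_upwards [ha] with ω hω
      have hNr : (N : ℝ) ≠ 0 := by exact_mod_cast hN0
      set r := (N : ℝ) ^ (-(1 / 2) : ℝ) with hrdef
      have hr0 : 0 ≤ r := by positivity
      have hr2 : r ^ 2 = (N : ℝ)⁻¹ := natCast_rpow_neg_half_sq N
      have h := norm_inarLogChar_le hlam hω.1 hω.2 hN (θ := fun k => r * θ k) (fun k => by
        rw [abs_mul, abs_of_nonneg hr0]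
        exact mul_le_mul_of_nonneg_left (hθ k) hr0) m
      rw [norm_mul, Complex.norm_natCast]
      calc (N : ℝ) * _ ≤ N * (2 * (lam * (m + 1 / (1 - a ω)) * (m ^ 2 * (r * U) ^ 2))) := by
            gcongr
            exact (norm_exp_sub_one_le_two_mul
              (norm_exp_inarLogChar_le hlam hω.1 hω.2 _ m)).trans (by gcongr)
        _ = (N * r ^ 2) * (2 * (lam * (m + 1 / (1 - a ω)) * (m ^ 2 * U ^ 2))) := by ring
        _ = _ := by rw [hr2, mul_inv_cancel₀ hNr, one_mul]
    · exact ((((integrable_const _).add hint).const_mul lam).mul_const _).const_mul 2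
    · filter_upwards [ha] with ω hω
      exact tendsto_natCast_mul_exp_sub_one
        (tendsto_natCast_mul_inarLogChar hlam hω.1 hω.2 hθ m)
  convert hlim using 1
  · ext N
    rw [integral_const_mul, integral_sub (hI N) (integrable_const _)]
    simp
  · rw [integral_complex_ofReal]
    congr 2
    rw [integral_neg, neg_div, ← integral_div]
    congr 2
    ext ω
    rw [mul_comm (2 : ℝ), ← div_div]
    ring

/-- The limit of the averaged quadratic forms for a growing time horizon. -/
theorem tendsto_integral_geomQuadForm (hlam : 0 < lam) (ham : Measurable a)
    (ha : ∀ᵐ ω ∂μ, a ω ∈ Set.Ioo (0 : ℝ) 1) (hint : Integrable (fun ω => 1 / (1 - a ω) ^ 2) μ)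
    {I : Finset ℝ≥0} (u : I → ℝ) :
    Tendsto (fun n : ℕ => ∫ ω, lam / (1 - a ω) *
      geomQuadForm (a ω) (fun k => (n : ℝ) ^ (-(1 / 2) : ℝ) * stepWeight u n k)
        (stepHorizon I n) ∂μ) atTop
      (𝓝 (lam * (∫ ω, (1 + a ω) / (1 - a ω) ^ 2 ∂μ) * wienerForm u)) := by
  set T : ℝ := ((∑ t ∈ I, t : ℝ≥0) : ℝ)
  set U : ℝ := ∑ t : I, |u t|
  have hU : 0 ≤ U := Finset.sum_nonneg fun _ _ => abs_nonneg _
  have hform : ∀ (x : ℝ) (n : ℕ),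
      geomQuadForm x (fun k => (n : ℝ) ^ (-(1 / 2) : ℝ) * stepWeight u n k) (stepHorizon I n)
        = geomQuadForm x (stepWeight u n) (stepHorizon I n) / n := by
    intro x n
    rw [geomQuadForm_const_mul, natCast_rpow_neg_half_sq]
    ring
  simp only [hform]
  have hlim : Tendsto (fun n : ℕ => ∫ ω, lam / (1 - a ω) *
      (geomQuadForm (a ω) (stepWeight u n) (stepHorizon I n) / n) ∂μ) atTop
      (𝓝 (∫ ω, lam / (1 - a ω) * ((1 + a ω) / (1 - a ω) * wienerForm u) ∂μ)) := by
    -- The factor `T + 1` comes from `stepHorizon I n ≤ n T + 1 ≤ n (T + 1)` for `n ≥ 1`. Here the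
    -- full second moment of `1 / (1 - a)` is needed.
    refine tendsto_integral_filter_of_dominated_convergence
      (fun ω => lam * ((T + 1) * (2 * U ^ 2)) * (1 / (1 - a ω) ^ 2)) ?_ ?_ ?_ ?_
    · refine Eventually.of_forall fun n => ?_
      have := (measurable_geomQuadForm (stepWeight u n) (stepHorizon I n)).comp ham
      refine Measurable.aestronglyMeasurable ?_
      exact (by fun_prop : Measurable fun ω => lam / (1 - a ω)).mul (this.div_const _)
    · filter_upwards [eventually_ge_atTop 1] with n hn
      filter_upwards [ha] with ω hω
      have h1 : 0 < 1 - a ω := by linarith [hω.2]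
      have hn' : (1 : ℝ) ≤ n := by exact_mod_cast hn
      have hn0 : (0 : ℝ) < n := by linarith
      have hh : (stepHorizon I n : ℝ) ≤ n * (T + 1) := by
        have := stepHorizon_le I n
        simp only [T]
        linarith
      have hq := abs_geomQuadForm_le hω.1 hω.2 (abs_stepWeight_le u n) (stepHorizon I n)
      rw [norm_mul, Real.norm_of_nonneg (by positivity), norm_div, Real.norm_natCast,
        Real.norm_eq_abs]
      calc lam / (1 - a ω) * (|geomQuadForm (a ω) (stepWeight u n) (stepHorizon I n)| / n)
          ≤ lam / (1 - a ω) * ((n * (T + 1)) * (2 * U ^ 2 / (1 - a ω)) / n) := by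
            have h2 : (stepHorizon I n : ℝ) * (2 * U ^ 2 / (1 - a ω))
                ≤ (n * (T + 1)) * (2 * U ^ 2 / (1 - a ω)) := by gcongr
            have h3 := hq.trans h2
            gcongr
        _ = _ := by field_simp
    · exact hint.const_mul _
    · filter_upwards [ha] with ω hω
      exact (tendsto_geomQuadForm_stepWeight_div hω.1 hω.2 u).const_mul _
  convert hlim using 2
  rw [← integral_const_mul, ← integral_mul_const]
  refine integral_congr_ae ?_
  filter_upwards [ha] with ω hω
  have h1 : 1 - a ω ≠ 0 := by linarith [hω.2]
  field_simp

/-- The pointwise limit for a growing time horizon. -/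
theorem tendsto_inarLogChar_stepWeight {lam a : ℝ} (hlam : 0 < lam) (ha0 : 0 < a) (ha1 : a < 1)
    {I : Finset ℝ≥0} (u : I → ℝ) (c : ℝ) :
    Tendsto (fun n : ℕ => inarLogChar lam a
      (fun k => (n : ℝ) ^ (-(1 / 2) : ℝ) * c * stepWeight u n k) (stepHorizon I n)) atTop
      (𝓝 (((-(lam * ((1 + a) / (1 - a) ^ 2) * (c ^ 2 * wienerForm u)) / 2 : ℝ)) : ℂ)) := by
  have h1a : 0 < 1 - a := by linarith
  set T : ℝ := ((∑ t ∈ I, t : ℝ≥0) : ℝ)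
  have hT : 0 ≤ T := NNReal.coe_nonneg _
  set U : ℝ := |c| * ∑ t : I, |u t|
  have hU : 0 ≤ U := by positivity
  have hr := tendsto_natCast_rpow_neg_half
  have hb : Tendsto (fun n : ℕ => lam * (T + 1 + 1 / (1 - a)) * (3 * U ^ 3 / (1 - a) ^ 3)
      * (n : ℝ) ^ (-(1 / 2) : ℝ)) atTop (𝓝 0) := by
    simpa using hr.const_mul (lam * (T + 1 + 1 / (1 - a)) * (3 * U ^ 3 / (1 - a) ^ 3))
  have hsmall : ∀ᶠ n : ℕ in atTop, (n : ℝ) ^ (-(1 / 2) : ℝ) * U ≤ 1 := by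
    have h : Tendsto (fun n : ℕ => (n : ℝ) ^ (-(1 / 2) : ℝ) * U) atTop (𝓝 0) := by
      simpa using hr.mul_const U
    exact h.eventually (ge_mem_nhds one_pos)
  -- The horizon is `O(n)` and the weights are `O(n ^ (-1/2))`, so the cubic error is `O(n ^
  -- (-1/2))` for fixed `a`.
  have herr : Tendsto (fun n : ℕ => inarLogChar lam a
      (fun k => (n : ℝ) ^ (-(1 / 2) : ℝ) * c * stepWeight u n k) (stepHorizon I n)
      + ((lam / (2 * (1 - a)) * (c ^ 2 * (geomQuadForm a (stepWeight u n) (stepHorizon I n) / n))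
        : ℝ) : ℂ)) atTop (𝓝 0) := by
    refine squeeze_zero_norm' ?_ hb
    filter_upwards [hsmall, eventually_ge_atTop 1] with n hn hn1
    have hn' : (1 : ℝ) ≤ n := by exact_mod_cast hn1
    have hn0 : (n : ℝ) ≠ 0 := by linarith
    set r := (n : ℝ) ^ (-(1 / 2) : ℝ) with hrdef
    have hr0 : 0 ≤ r := by positivity
    have hr2 : r ^ 2 = (n : ℝ)⁻¹ := natCast_rpow_neg_half_sq n
    have h := norm_inarLogChar_add_le hlam ha0 ha1 hn (θ := fun k => r * c * stepWeight u n k)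
      (fun k => by
        rw [abs_mul, abs_mul, abs_of_nonneg hr0, mul_assoc]
        have := abs_stepWeight_le u n k
        simp only [U]
        gcongr) (stepHorizon I n)
    have e : geomQuadForm a (fun k => r * c * stepWeight u n k) (stepHorizon I n)
        = c ^ 2 * (geomQuadForm a (stepWeight u n) (stepHorizon I n) / n) := by
      rw [geomQuadForm_const_mul, mul_pow, hr2]
      ring
    rw [e] at h
    refine h.trans ?_
    have hh : (stepHorizon I n : ℝ) + 1 / (1 - a) ≤ n * (T + 1 + 1 / (1 - a)) := by
      have h1 := stepHorizon_le I n
      have h2 : 1 / (1 - a) ≤ n * (1 / (1 - a)) := le_mul_of_one_le_left (by positivity) hn'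
      simp only [T]
      linarith
    calc lam * (stepHorizon I n + 1 / (1 - a)) * (3 * (r * U) ^ 3 / (1 - a) ^ 3)
        ≤ lam * (n * (T + 1 + 1 / (1 - a))) * (3 * (r * U) ^ 3 / (1 - a) ^ 3) := by gcongr
      _ = (n * r ^ 2) * (lam * (T + 1 + 1 / (1 - a)) * (3 * U ^ 3 / (1 - a) ^ 3) * r) := by ring
      _ = _ := by rw [hr2, mul_inv_cancel₀ hn0, one_mul]
  have hmain : Tendsto (fun n : ℕ => ((lam / (2 * (1 - a)) *
      (c ^ 2 * (geomQuadForm a (stepWeight u n) (stepHorizon I n) / n)) : ℝ) : ℂ)) atTop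
      (𝓝 ((lam / (2 * (1 - a)) * (c ^ 2 * ((1 + a) / (1 - a) * wienerForm u)) : ℝ) : ℂ)) :=
    (Complex.continuous_ofReal.tendsto _).comp
      (((tendsto_geomQuadForm_stepWeight_div ha0 ha1 u).const_mul (c ^ 2)).const_mul _)
  have h := herr.sub hmain
  have e : (0 : ℂ) - ((lam / (2 * (1 - a)) * (c ^ 2 * ((1 + a) / (1 - a) * wienerForm u)) : ℝ) : ℂ)
      = (((-(lam * ((1 + a) / (1 - a) ^ 2) * (c ^ 2 * wienerForm u)) / 2 : ℝ)) : ℂ) := by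
    rw [zero_sub, ← Complex.ofReal_neg]
    congr 1
    field_simp
  rw [e] at h
  refine h.congr fun n => ?_
  ring

/-- The limit for a fixed number of copies and a growing time horizon. -/
theorem tendsto_integral_exp_inarLogChar_stepWeight [IsProbabilityMeasure μ]
    (hlam : 0 < lam) (ham : Measurable a)
    (ha : ∀ᵐ ω ∂μ, a ω ∈ Set.Ioo (0 : ℝ) 1) {I : Finset ℝ≥0} (u : I → ℝ) (c : ℝ) :
    Tendsto (fun n : ℕ => ∫ ω, Complex.exp (inarLogChar lam (a ω)
      (fun k => (n : ℝ) ^ (-(1 / 2) : ℝ) * c * stepWeight u n k) (stepHorizon I n)) ∂μ) atTop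
      (𝓝 (∫ ω, Complex.exp (((-(lam * ((1 + a ω) / (1 - a ω) ^ 2) * (c ^ 2 * wienerForm u)) / 2
        : ℝ)) : ℂ) ∂μ)) := by
  -- Characteristic functions are bounded by 1, so with finitely many copies no moment of `1 / (1 -
  -- a)` enters.
  refine tendsto_integral_filter_of_dominated_convergence (fun _ => 1) ?_ ?_
    (integrable_const _) ?_
  · exact Eventually.of_forall fun n =>
      ((measurable_inarLogChar lam _ _).comp ham).cexp.aestronglyMeasurable
  · refine Eventually.of_forall fun n => ?_
    filter_upwards [ha] with ω hω
    exact norm_exp_inarLogChar_le hlam hω.1 hω.2 _ _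
  · filter_upwards [ha] with ω hω
    exact (Complex.continuous_exp.tendsto _).comp
      (tendsto_inarLogChar_stepWeight hlam hω.1 hω.2 u c)

/-- The limit of the powers of Laplace transforms at small arguments. -/
theorem tendsto_integral_exp_div_pow [IsProbabilityMeasure μ]
    {V : Ω → ℝ} (hV : Integrable V μ) (hV0 : ∀ᵐ ω ∂μ, 0 ≤ V ω) :
    Tendsto (fun N : ℕ => (∫ ω, Complex.exp (((-(V ω / N) : ℝ)) : ℂ) ∂μ) ^ N) atTop
      (𝓝 (Complex.exp (((-(∫ ω, V ω ∂μ) : ℝ)) : ℂ))) := by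
  refine tendsto_pow_of_tendsto_natCast_mul_sub_one ?_
  have hm : ∀ N : ℕ, AEStronglyMeasurable (fun ω => Complex.exp (((-(V ω / N) : ℝ)) : ℂ)) μ :=
    fun N => by
      have := hV.aestronglyMeasurable.aemeasurable
      exact (by fun_prop : AEMeasurable (fun ω => Complex.exp (((-(V ω / N) : ℝ)) : ℂ)) μ)
        |>.aestronglyMeasurable
  have hnorm : ∀ N : ℕ, ∀ ω, 0 ≤ V ω → ‖Complex.exp (((-(V ω / N) : ℝ)) : ℂ)‖ ≤ 1 := by
    intro N ω hω
    rw [Complex.norm_exp, Complex.ofReal_re, Real.exp_le_one_iff, neg_nonpos]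
    positivity
  have hI : ∀ N : ℕ, Integrable (fun ω => Complex.exp (((-(V ω / N) : ℝ)) : ℂ)) μ := fun N =>
    Integrable.of_bound (hm N) 1 (hV0.mono fun ω hω => hnorm N ω hω)
  have hlim : Tendsto (fun N : ℕ => ∫ ω, (N : ℂ) * (Complex.exp (((-(V ω / N) : ℝ)) : ℂ) - 1) ∂μ)
      atTop (𝓝 (∫ ω, ((-V ω : ℝ) : ℂ) ∂μ)) := by
    refine tendsto_integral_filter_of_dominated_convergence (fun ω => 2 * V ω) ?_ ?_
      (hV.const_mul 2) ?_
    · exact Eventually.of_forall fun N =>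
        ((hm N).sub aestronglyMeasurable_const).const_mul _
    · filter_upwards [eventually_ne_atTop 0] with N hN0
      have hNr : (N : ℝ) ≠ 0 := by exact_mod_cast hN0
      filter_upwards [hV0] with ω hω
      rw [norm_mul, Complex.norm_natCast]
      calc (N : ℝ) * _ ≤ N * (2 * ‖(((-(V ω / N) : ℝ)) : ℂ)‖) := by
            gcongr
            exact norm_exp_sub_one_le_two_mul (hnorm N ω hω)
        _ = 2 * V ω := by
            rw [Complex.norm_real, norm_neg, Real.norm_of_nonneg (by positivity)]
            field_simp
    · refine ae_of_all _ fun ω => tendsto_natCast_mul_exp_sub_one ?_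
      refine tendsto_const_nhds.congr' ?_
      filter_upwards [eventually_ne_atTop 0] with N hN0
      have hNc : (N : ℂ) ≠ 0 := by exact_mod_cast hN0
      push_cast
      field_simp
  convert hlim using 1
  · ext N
    rw [integral_const_mul, integral_sub (hI N) (integrable_const _)]
    simp
  · rw [integral_complex_ofReal, integral_neg]

end Limits

/-! ### The characteristic function of the aggregated process -/

section Aggregated

variable {Ω : Type*} [MeasurableSpace Ω] {μ : Measure Ω} {lam : ℝ} {α : ℕ → Ω → ℝ}
  {Y : ℕ → NoiseIndex → Ω → ℕ}

theorem measurable_inarProcess {Y : NoiseIndex → Ω → ℕ} (hY : ∀ i, Measurable (Y i)) (k : ℕ) :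
    Measurable (inarProcess Y k) := by
  have h := (measurable_canonicalINAR k).comp (measurable_pi_lambda _ hY)
  convert h using 1
  ext ω
  exact inarProcess_eq_canonicalINAR Y k ω

theorem measurable_aggregated (hY : ∀ j, IsRandomizedINARNoise μ lam (α j) (Y j)) (N n : ℕ)
    (t : ℝ≥0) : Measurable (aggregated μ α (fun j => inarProcess (Y j)) N n t) := by
  refine Finset.measurable_fun_sum _ fun j _ => Finset.measurable_fun_sum _ fun k _ => ?_
  refine Measurable.sub ?_ ?_
  · exact (Measurable.of_discrete (f := fun n : ℕ => (n : ℝ))).comp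
      (measurable_inarProcess (hY j).measurable_noise k)
  · exact (stronglyMeasurable_condExp.mono (hY j).measurable_param.comap_le).measurable

/-- The characteristic function of a linear combination of values of the aggregated process. -/
theorem integral_exp_aggregated [IsProbabilityMeasure μ] (hlam : 0 < lam)
    (hY : ∀ j, IsRandomizedINARNoise μ lam (α j) (Y j))
    (h_indep : iIndepFun (fun j ω => ((α j ω, fun i => Y j i ω) : ℝ × (NoiseIndex → ℕ))) μ)
    (hlaw : ∀ j, μ.map (α j) = μ.map (α 0))
    (ha : ∀ j, ∀ᵐ ω ∂μ, α j ω ∈ Set.Ioo (0 : ℝ) 1)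
    (hint : ∀ j, Integrable (fun ω => 1 / (1 - α j ω)) μ)
    {I : Finset ℝ≥0} (u : I → ℝ) (c : ℝ) (N n : ℕ) :
    ∫ ω, Complex.exp (Complex.I * ((∑ t : I, u t *
        (c * aggregated μ α (fun j => inarProcess (Y j)) N n t ω) : ℝ) : ℂ)) ∂μ
      = (∫ ω, Complex.exp (inarLogChar lam (α 0 ω) (fun k => c * stepWeight u n k)
          (stepHorizon I n)) ∂μ) ^ N := by
  set θ : ℕ → ℝ := fun k => c * stepWeight u n k with hθ
  set m := stepHorizon I n with hm
  set F : ℝ × (NoiseIndex → ℕ) → ℂ := fun p => Complex.exp (Complex.I * centredSum lam θ m p)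
    with hF
  have hFm : Measurable F := by
    have := measurable_centredSum lam θ m
    fun_prop
  -- Countably many pairs `(j, k)` share one null set, off which all conditional means take their
  -- explicit value.
  have hce : ∀ᵐ ω ∂μ, ∀ j k, (μ[fun ω' => (inarProcess (Y j) k ω' : ℝ) | sigmaOf (α j)]) ω
      = lam / (1 - α j ω) := by
    rw [ae_all_iff]
    intro j
    rw [ae_all_iff]
    exact fun k => (hY j).condExp_inarProcess_ae_eq hlam (ha j) (hint j) k
  have hprod : ∀ᵐ ω ∂μ, Complex.exp (Complex.I * ((∑ t : I, u t *
        (c * aggregated μ α (fun j => inarProcess (Y j)) N n t ω) : ℝ) : ℂ))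
      = ∏ j : Fin N, F (α j ω, fun i => Y j i ω) := by
    filter_upwards [hce] with ω hω
    rw [Fin.prod_univ_eq_prod_range (fun j => F (α j ω, fun i => Y j i ω)) N, hF]
    dsimp only
    rw [← Complex.exp_sum, ← Finset.mul_sum, ← Complex.ofReal_sum]
    congr 3
    simp only [aggregated, hω]
    trans ∑ t : I, ∑ j ∈ Finset.range N, u t * (c * ∑ k ∈ Finset.Icc 1 ⌊(n : ℝ) * (t : ℝ≥0)⌋₊,
      ((inarProcess (Y j) k ω : ℝ) - lam / (1 - α j ω)))
    · exact Finset.sum_congr rfl fun t _ => by rw [Finset.mul_sum, Finset.mul_sum]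
    rw [Finset.sum_comm]
    refine Finset.sum_congr rfl fun j _ => ?_
    have h := sum_mul_partialSum_eq u n fun k => (inarProcess (Y j) k ω : ℝ) - lam / (1 - α j ω)
    simp only [centredSum, hθ, ← inarProcess_eq_canonicalINAR, mul_assoc, ← Finset.mul_sum]
    rw [← h, Finset.mul_sum]
    refine Finset.sum_congr rfl fun t _ => ?_
    ring
  have hmeas : ∀ j, Measurable fun ω => ((α j ω, fun i => Y j i ω) : ℝ × (NoiseIndex → ℕ)) :=
    fun j => (hY j).measurable_param.prodMk (hY j).measurable_noise_pi
  have h := (h_indep.precomp (g := fun j : Fin N => (j : ℕ)) Fin.val_injective).integral_fun_prod_comp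
    (f := fun _ => F) (fun j => (hmeas j).aemeasurable) fun j => hFm.aestronglyMeasurable
  rw [integral_congr_ae hprod]
  refine h.trans ?_
  have hfac : ∀ j : ℕ, ∫ ω, F (α j ω, fun i => Y j i ω) ∂μ
      = ∫ ω, Complex.exp (inarLogChar lam (α 0 ω) θ m) ∂μ := by
    intro j
    have hL : Measurable fun x => Complex.exp (inarLogChar lam x θ m) :=
      (measurable_inarLogChar lam θ m).cexp
    rw [hF, (hY j).integral_exp_centredSum hlam (ha j) θ m,
      ← integral_map (hY j).measurable_param.aemeasurable hL.aestronglyMeasurable, hlaw j,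
      integral_map (hY 0).measurable_param.aemeasurable hL.aestronglyMeasurable]
  simp only [hfac, Finset.prod_const, Finset.card_univ, Fintype.card_fin]

end Aggregated

/-! ### The intermediate limit processes -/

/-- The partial sum process of the Gaussian sequence with coefficients `L`, scaled by `n ^ (-1/2)`,
as a function of the underlying white noise. -/
noncomputable def gaussianPartialSum (L : ℕ → ℕ → ℝ) (n : ℕ) (x : ℕ → ℝ) (t : ℝ≥0) : ℝ :=
  (n : ℝ) ^ (-(1 / 2) : ℝ) *
    ∑ k ∈ Finset.Icc 1 ⌊(n : ℝ) * t⌋₊, ∑ i ∈ Finset.range (k + 1), L k i * x i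

theorem measurable_gaussianPartialSum (L : ℕ → ℕ → ℝ) (n : ℕ) :
    Measurable (gaussianPartialSum L n) := by
  unfold gaussianPartialSum
  fun_prop

section Intermediate

variable {Ω : Type*} [MeasurableSpace Ω] {μ : Measure Ω} {lam : ℝ} {a : Ω → ℝ}

theorem integral_exp_gaussianPartialSum (ham : Measurable a)
    (ha : ∀ᵐ ω ∂μ, a ω ∈ Set.Ioo (0 : ℝ) 1) (hint : Integrable (fun ω => 1 / (1 - a ω)) μ)
    {L : ℕ → ℕ → ℝ} (hL0 : ∀ k i, k < i → L k i = 0)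
    (hL : ∀ m k l, k < m → l < m → ∑ i ∈ Finset.range m, L k i * L l i
        = ∫ ω, lam / (1 - a ω) * a ω ^ Nat.dist k l ∂μ)
    {I : Finset ℝ≥0} (u : I → ℝ) (n : ℕ) :
    ∫ x, Complex.exp (Complex.I * ((∑ t : I, u t * gaussianPartialSum L n x t : ℝ) : ℂ))
        ∂(Measure.infinitePi fun _ : ℕ => gaussianReal 0 1)
      = Complex.exp (((-(∫ ω, lam / (1 - a ω) * geomQuadForm (a ω)
          (fun k => (n : ℝ) ^ (-(1 / 2) : ℝ) * stepWeight u n k) (stepHorizon I n) ∂μ) / 2 : ℝ))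
            : ℂ) := by
  set θ : ℕ → ℝ := fun k => (n : ℝ) ^ (-(1 / 2) : ℝ) * stepWeight u n k with hθ
  set m := stepHorizon I n with hm
  have hlin : ∀ x : ℕ → ℝ, ∑ t : I, u t * gaussianPartialSum L n x t
      = ∑ i ∈ Finset.range m, (∑ k ∈ Finset.range m, θ k * L k i) * x i := by
    intro x
    have h := sum_mul_partialSum_eq u n fun k => ∑ i ∈ Finset.range (k + 1), L k i * x i
    have h1 : ∑ t : I, u t * gaussianPartialSum L n x t = ∑ k ∈ Finset.range m,
        θ k * ∑ i ∈ Finset.range (k + 1), L k i * x i := by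
      simp only [hθ, mul_assoc, ← Finset.mul_sum]
      rw [← h, Finset.mul_sum]
      refine Finset.sum_congr rfl fun t _ => ?_
      rw [gaussianPartialSum]
      ring
    rw [h1]
    simp only [Finset.sum_mul]
    rw [Finset.sum_comm]
    refine Finset.sum_congr rfl fun k hk => ?_
    -- Triangularity makes each Gaussian value a finite combination that does not depend on the
    -- horizon, so one map of the white noise yields the whole path.
    have h2 : ∑ i ∈ Finset.range (k + 1), L k i * x i = ∑ i ∈ Finset.range m, L k i * x i := by
      refine Finset.sum_subset ?_ fun i _ hi => ?_
      · intro i hi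
        simp only [Finset.mem_range] at hi hk ⊢
        omega
      · rw [hL0 k i (by simpa using hi), zero_mul]
    rw [h2, Finset.mul_sum]
    exact Finset.sum_congr rfl fun i _ => by ring
  simp only [hlin]
  rw [integral_exp_sum_infinitePi_gaussianReal]
  have hterm : ∀ k l, Integrable (fun ω => lam / (1 - a ω) * a ω ^ Nat.dist k l) μ := by
    intro k l
    refine (hint.const_mul |lam|).mono
      (by fun_prop : Measurable fun ω => lam / (1 - a ω) * a ω ^ Nat.dist k l).aestronglyMeasurable ?_
    filter_upwards [ha] with ω hω
    have h1 : 0 < 1 - a ω := by linarith [hω.2]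
    rw [norm_mul, norm_mul, norm_div, norm_pow, Real.norm_of_nonneg hω.1.le,
      Real.norm_of_nonneg h1.le, norm_div, norm_one, Real.norm_of_nonneg h1.le, Real.norm_eq_abs,
      Real.norm_eq_abs, abs_abs, mul_one_div]
    exact mul_le_of_le_one_right (by positivity) (pow_le_one₀ hω.1.le hω.2.le)
  have hsq : ∑ i ∈ Finset.range m, (∑ k ∈ Finset.range m, θ k * L k i) ^ 2
      = ∫ ω, lam / (1 - a ω) * geomQuadForm (a ω) θ m ∂μ := by
    have h1 : ∀ ω, lam / (1 - a ω) * geomQuadForm (a ω) θ m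
        = ∑ k ∈ Finset.range m, ∑ l ∈ Finset.range m,
          (θ k * θ l) * (lam / (1 - a ω) * a ω ^ Nat.dist k l) := by
      intro ω
      rw [geomQuadForm, Finset.mul_sum]
      refine Finset.sum_congr rfl fun k _ => ?_
      rw [Finset.mul_sum]
      exact Finset.sum_congr rfl fun l _ => by ring
    simp only [h1]
    rw [integral_finsetSum _ fun k _ => integrable_finsetSum _ fun l _ =>
      (hterm k l).const_mul _]
    have h2 : ∀ k, ∫ ω, ∑ l ∈ Finset.range m,
        (θ k * θ l) * (lam / (1 - a ω) * a ω ^ Nat.dist k l) ∂μ = ∑ l ∈ Finset.range m,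
        (θ k * θ l) * ∫ ω, (lam / (1 - a ω) * a ω ^ Nat.dist k l) ∂μ := by
      intro k
      rw [integral_finsetSum _ fun l _ => (hterm k l).const_mul _]
      exact Finset.sum_congr rfl fun l _ => integral_const_mul _ _
    simp only [h2, sq, Finset.sum_mul_sum]
    rw [Finset.sum_comm]
    refine Finset.sum_congr rfl fun k hk => ?_
    rw [Finset.sum_comm]
    refine Finset.sum_congr rfl fun l hl => ?_
    rw [← hL m k l (Finset.mem_range.1 hk) (Finset.mem_range.1 hl), Finset.mul_sum]
    exact Finset.sum_congr rfl fun i _ => by ring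
  rw [hsq]

end Intermediate

/-- The average of the conditional long-run variances of the first `N` copies. -/
noncomputable def meanLongRunVariance {Ω : Type*} (lam : ℝ) (α : ℕ → Ω → ℝ) (N : ℕ) (ω : Ω) : ℝ :=
  (N : ℝ)⁻¹ * ∑ j ∈ Finset.range N, lam * ((1 + α j ω) / (1 - α j ω) ^ 2)

theorem measurable_meanLongRunVariance {Ω : Type*} [MeasurableSpace Ω] (lam : ℝ) {α : ℕ → Ω → ℝ}
    (hα : ∀ j, Measurable (α j)) (N : ℕ) : Measurable (meanLongRunVariance lam α N) := by
  unfold meanLongRunVariance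
  fun_prop

/-! ### Wiener process with an independent random variance. -/

section MixedWiener

variable {Ω Ω' : Type*} [MeasurableSpace Ω] [MeasurableSpace Ω'] {μ : Measure Ω}
  [IsProbabilityMeasure μ] {ν : Measure Ω'} [IsProbabilityMeasure ν] {lam : ℝ}
  {α : ℕ → Ω → ℝ} {B : ℝ≥0 → Ω' → ℝ}

/-- The characteristic function of a Wiener process with an independent random variance. -/
theorem integral_exp_mixedWiener (hlam : 0 < lam) (hα : ∀ j, Measurable (α j))
    (h_indep : iIndepFun α μ) (hlaw : ∀ j, μ.map (α j) = μ.map (α 0))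
    (ha : ∀ j, ∀ᵐ ω ∂μ, α j ω ∈ Set.Ioo (0 : ℝ) 1)
    (hB : IsPreBrownianReal B ν) (hBm : ∀ t, Measurable (B t)) {I : Finset ℝ≥0} (u : I → ℝ)
    (N : ℕ) :
    ∫ p, Complex.exp (Complex.I * ((∑ t : I, u t *
        (√(meanLongRunVariance lam α N p.1) * B t p.2) : ℝ) : ℂ)) ∂(μ.prod ν)
      = (∫ ω, Complex.exp (((-(lam * ((1 + α 0 ω) / (1 - α 0 ω) ^ 2)
          * (((N : ℝ) ^ (-(1 / 2) : ℝ)) ^ 2 * wienerForm u)) / 2 : ℝ)) : ℂ) ∂μ) ^ N := by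
  have hVm := measurable_meanLongRunVariance lam hα N
  set F : ℝ → ℂ := fun x => Complex.exp (((-(lam * ((1 + x) / (1 - x) ^ 2)
          * (((N : ℝ) ^ (-(1 / 2) : ℝ)) ^ 2 * wienerForm u)) / 2 : ℝ)) : ℂ) with hF
  have hFm : Measurable F := by fun_prop
  have hmeas : Measurable fun p : Ω × Ω' => Complex.exp (Complex.I * ((∑ t : I, u t *
        (√(meanLongRunVariance lam α N p.1) * B t p.2) : ℝ) : ℂ)) := by
    fun_prop
  have hI : Integrable (fun p : Ω × Ω' => Complex.exp (Complex.I * ((∑ t : I, u t *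
        (√(meanLongRunVariance lam α N p.1) * B t p.2) : ℝ) : ℂ))) (μ.prod ν) := by
    refine Integrable.of_bound hmeas.aestronglyMeasurable 1 (ae_of_all _ fun p => ?_)
    rw [mul_comm, Complex.norm_exp_ofReal_mul_I]
  rw [integral_prod _ hI]
  simp only [hB.integral_exp_sum u]
  have hprod : ∀ᵐ ω ∂μ, Complex.exp (((-(√(meanLongRunVariance lam α N ω) ^ 2 * wienerForm u) / 2
      : ℝ)) : ℂ) = ∏ j : Fin N, F (α j ω) := by
    filter_upwards [ae_all_iff.2 ha] with ω hω
    -- Nonnegativity of the averaged variance lets the square root cancel; the exponential of the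
    -- average then factors over the independent copies.
    have hV0 : 0 ≤ meanLongRunVariance lam α N ω := by
      refine mul_nonneg (by positivity) (Finset.sum_nonneg fun j _ => ?_)
      have h1 : 0 < 1 - α j ω := by linarith [(hω j).2]
      have h2 := (hω j).1
      positivity
    rw [Real.sq_sqrt hV0, Fin.prod_univ_eq_prod_range (fun j => F (α j ω)) N, hF]
    dsimp only
    rw [← Complex.exp_sum, ← Complex.ofReal_sum, natCast_rpow_neg_half_sq, meanLongRunVariance]
    congr 2
    rw [neg_div, mul_assoc, Finset.sum_mul, Finset.mul_sum, Finset.sum_div, ← Finset.sum_neg_distrib]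
    exact Finset.sum_congr rfl fun j _ => by ring
  rw [integral_congr_ae hprod]
  have h := (h_indep.precomp (g := fun j : Fin N => (j : ℕ)) Fin.val_injective).integral_fun_prod_comp
    (f := fun _ => F) (fun j => (hα j).aemeasurable) fun j => hFm.aestronglyMeasurable
  refine h.trans ?_
  have hfac : ∀ j : ℕ, ∫ ω, F (α j ω) ∂μ = ∫ ω, F (α 0 ω) ∂μ := fun j => by
    rw [← integral_map (hα j).aemeasurable hFm.aestronglyMeasurable, hlaw j,
      integral_map (hα 0).aemeasurable hFm.aestronglyMeasurable]
  simp only [hfac, Finset.prod_const, Finset.card_univ, Fintype.card_fin]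
  rfl

end MixedWiener

/-! ### The two iterated limits. -/

section Main

variable {Ω Ω' : Type*} [MeasurableSpace Ω] [MeasurableSpace Ω'] {μ : Measure Ω}
  [IsProbabilityMeasure μ] {ν : Measure Ω'} [IsProbabilityMeasure ν] {lam : ℝ}
  {α : ℕ → Ω → ℝ} {Y : ℕ → NoiseIndex → Ω → ℕ} {B : ℝ≥0 → Ω' → ℝ} {σ : ℝ}

/-- First the number of copies, then the time horizon tends to infinity. -/
theorem isIteratedFDDLimit_copies_horizon (hlam : 0 < lam)
    (hY : ∀ j, IsRandomizedINARNoise μ lam (α j) (Y j))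
    (h_indep : iIndepFun (fun j ω => ((α j ω, fun i => Y j i ω) : ℝ × (NoiseIndex → ℕ))) μ)
    (hlaw : ∀ j, μ.map (α j) = μ.map (α 0))
    (ha : ∀ j, ∀ᵐ ω ∂μ, α j ω ∈ Set.Ioo (0 : ℝ) 1)
    (hint : ∀ j, Integrable (fun ω => 1 / (1 - α j ω) ^ 2) μ)
    (hB : IsPreBrownianReal B ν)
    (hσ : σ ^ 2 = lam * ∫ ω, (1 + α 0 ω) / (1 - α 0 ω) ^ 2 ∂μ) :
    IsIteratedFDDLimit
      (fun n N t ω => ((n : ℝ) * (N : ℝ)) ^ (-(1 / 2) : ℝ)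
        * aggregated μ α (fun j => inarProcess (Y j)) N n t ω)
      (fun t ω => σ * B t ω) μ ν := by
  have hα : ∀ j, Measurable (α j) := fun j => (hY j).measurable_param
  have hint1 : ∀ j, Integrable (fun ω => 1 / (1 - α j ω)) μ := fun j =>
    integrable_div_one_sub_of_sq (hα j) (ha j) (hint j)
  obtain ⟨L, hL0, hL⟩ := exists_lowerTriangular_mixedCovariance hlam (hα 0) (ha 0) (hint1 0)
  have hG := measurable_gaussianPartialSum L
  -- The intermediate law is that of the scaled partial sums of a centred Gaussian sequence with
  -- covariances `E (lam / (1 - α) * α ^ |k - l|)`.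
  obtain ⟨P, hP⟩ : ∃ P : ℕ → ProbabilityMeasure (ℝ≥0 → ℝ), ∀ n, (P n : Measure (ℝ≥0 → ℝ))
      = (Measure.infinitePi fun _ : ℕ => gaussianReal 0 1).map (gaussianPartialSum L n) :=
    ⟨fun n => ⟨_, Measure.isProbabilityMeasure_map (hG n).aemeasurable⟩, fun n => rfl⟩
  have hc : ∀ {I : Finset ℝ≥0} (u : I → ℝ) (n : ℕ),
      ∫ y, Complex.exp (Complex.I * ((∑ t : I, u t * y t : ℝ) : ℂ)) ∂(P n : Measure (ℝ≥0 → ℝ))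
      = Complex.exp (((-(∫ ω, lam / (1 - α 0 ω) * geomQuadForm (α 0 ω)
          (fun k => (n : ℝ) ^ (-(1 / 2) : ℝ) * stepWeight u n k) (stepHorizon I n) ∂μ) / 2 : ℝ))
            : ℂ) := by
    intro I u n
    rw [hP, ← integral_exp_gaussianPartialSum (hα 0) (ha 0) (hint1 0) hL0 hL u n,
      integral_map (hG n).aemeasurable]
    exact (by fun_prop : Measurable fun y : ℝ≥0 → ℝ => Complex.exp
      (Complex.I * ((∑ t : I, u t * y t : ℝ) : ℂ))).aestronglyMeasurable
  refine ⟨P, fun n _ => ?_, ?_⟩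
  · refine tendstoFDD_of_tendsto_charFun
      (fun N t => ((measurable_aggregated hY N n t).const_mul _).aemeasurable)
      (fun t => (measurable_pi_apply t).aemeasurable) fun I u => ?_
    simp only [hc u n]
    refine (tendsto_integral_exp_inarLogChar_pow hlam (hα 0) (ha 0) (hint1 0)
      (U := |(n : ℝ) ^ (-(1 / 2) : ℝ)| * ∑ t : I, |u t|)
      (θ := fun k => (n : ℝ) ^ (-(1 / 2) : ℝ) * stepWeight u n k) (fun k => ?_)
      (stepHorizon I n)).congr fun N => ?_
    · rw [abs_mul]
      gcongr
      exact abs_stepWeight_le u n k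
    · rw [integral_exp_aggregated hlam hY h_indep hlaw ha hint1 u,
        Real.mul_rpow (Nat.cast_nonneg n) (Nat.cast_nonneg N),
        mul_comm ((n : ℝ) ^ (-(1 / 2) : ℝ))]
      simp only [mul_assoc]
  · refine tendstoFDD_of_tendsto_charFun (fun n t => (measurable_pi_apply t).aemeasurable)
      (fun t => (hB.aemeasurable t).const_mul σ) fun I u => ?_
    simp only [hc u, hB.integral_exp_sum u σ, hσ]
    refine (Complex.continuous_exp.tendsto _).comp ((Complex.continuous_ofReal.tendsto _).comp ?_)
    exact ((tendsto_integral_geomQuadForm hlam (hα 0) (ha 0) (hint 0) u).neg).div_const 2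

/-- First the time horizon, then the number of copies tends to infinity. -/
theorem isIteratedFDDLimit_horizon_copies (hlam : 0 < lam)
    (hY : ∀ j, IsRandomizedINARNoise μ lam (α j) (Y j))
    (h_indep : iIndepFun (fun j ω => ((α j ω, fun i => Y j i ω) : ℝ × (NoiseIndex → ℕ))) μ)
    (hlaw : ∀ j, μ.map (α j) = μ.map (α 0))
    (ha : ∀ j, ∀ᵐ ω ∂μ, α j ω ∈ Set.Ioo (0 : ℝ) 1)
    (hint : ∀ j, Integrable (fun ω => 1 / (1 - α j ω) ^ 2) μ)
    (hB : IsPreBrownianReal B ν)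
    (hσ : σ ^ 2 = lam * ∫ ω, (1 + α 0 ω) / (1 - α 0 ω) ^ 2 ∂μ) :
    IsIteratedFDDLimit
      (fun N n t ω => ((n : ℝ) * (N : ℝ)) ^ (-(1 / 2) : ℝ)
        * aggregated μ α (fun j => inarProcess (Y j)) N n t ω)
      (fun t ω => σ * B t ω) μ ν := by
  have hα : ∀ j, Measurable (α j) := fun j => (hY j).measurable_param
  have hint1 : ∀ j, Integrable (fun ω => 1 / (1 - α j ω)) μ := fun j =>
    integrable_div_one_sub_of_sq (hα j) (ha j) (hint j)
  have hα_indep : iIndepFun α μ := h_indep.comp (fun _ => Prod.fst) fun _ => measurable_fst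
  -- Each `B t` is only almost everywhere measurable; a measurable version is needed for the path
  -- map `Φ` to be measurable on the product space.
  let B' : ℝ≥0 → Ω' → ℝ := fun t => (hB.aemeasurable t).mk (B t)
  have hB'm : ∀ t, Measurable (B' t) := fun t => (hB.aemeasurable t).measurable_mk
  have hB' : IsPreBrownianReal B' ν := hB.congr fun t => (hB.aemeasurable t).ae_eq_mk
  -- Given the parameters, the normalized sum of the `N` limiting Wiener processes has the law of
  -- one Wiener process with their averaged variance; the product space makes it independent of the
  -- parameters.
  let Φ : ℕ → Ω × Ω' → ℝ≥0 → ℝ := fun N p t => √(meanLongRunVariance lam α N p.1) * B' t p.2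
  have hΦ : ∀ N, Measurable (Φ N) := by
    intro N
    have := measurable_meanLongRunVariance lam hα N
    refine measurable_pi_lambda _ fun t => ?_
    have := hB'm t
    fun_prop
  obtain ⟨P, hP⟩ : ∃ P : ℕ → ProbabilityMeasure (ℝ≥0 → ℝ), ∀ N, (P N : Measure (ℝ≥0 → ℝ))
      = (μ.prod ν).map (Φ N) :=
    ⟨fun N => ⟨_, Measure.isProbabilityMeasure_map (hΦ N).aemeasurable⟩, fun N => rfl⟩
  have hc : ∀ {I : Finset ℝ≥0} (u : I → ℝ) (N : ℕ),
      ∫ y, Complex.exp (Complex.I * ((∑ t : I, u t * y t : ℝ) : ℂ)) ∂(P N : Measure (ℝ≥0 → ℝ))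
      = (∫ ω, Complex.exp (((-(lam * ((1 + α 0 ω) / (1 - α 0 ω) ^ 2)
          * (((N : ℝ) ^ (-(1 / 2) : ℝ)) ^ 2 * wienerForm u)) / 2 : ℝ)) : ℂ) ∂μ) ^ N := by
    intro I u N
    rw [hP, ← integral_exp_mixedWiener hlam hα hα_indep hlaw ha hB' hB'm u N,
      integral_map (hΦ N).aemeasurable]
    exact (by fun_prop : Measurable fun y : ℝ≥0 → ℝ => Complex.exp
      (Complex.I * ((∑ t : I, u t * y t : ℝ) : ℂ))).aestronglyMeasurable
  refine ⟨P, fun N _ => ?_, ?_⟩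
  · refine tendstoFDD_of_tendsto_charFun
      (fun n t => ((measurable_aggregated hY N n t).const_mul _).aemeasurable)
      (fun t => (measurable_pi_apply t).aemeasurable) fun I u => ?_
    simp only [hc u N]
    refine ((tendsto_integral_exp_inarLogChar_stepWeight hlam (hα 0) (ha 0) u
      ((N : ℝ) ^ (-(1 / 2) : ℝ))).pow N).congr fun n => ?_
    rw [integral_exp_aggregated hlam hY h_indep hlaw ha hint1 u,
      Real.mul_rpow (Nat.cast_nonneg n) (Nat.cast_nonneg N)]
  · refine tendstoFDD_of_tendsto_charFun (fun n t => (measurable_pi_apply t).aemeasurable)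
      (fun t => (hB.aemeasurable t).const_mul σ) fun I u => ?_
    simp only [hc u, hB.integral_exp_sum u σ, hσ]
    have hw : 0 ≤ wienerForm u := (hB.map_sum_mul u).2
    -- `V / N` is the conditional exponent of one copy, so this is the law of large numbers for the
    -- averaged variance, read on Laplace transforms.
    have h := tendsto_integral_exp_div_pow (μ := μ)
      (V := fun ω => (1 + α 0 ω) / (1 - α 0 ω) ^ 2 * (lam * wienerForm u / 2))
      ((integrable_one_add_div_sq (hα 0) (ha 0) (hint 0)).mul_const _) (by
        filter_upwards [ha 0] with ω hω
        have := hω.1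
        positivity)
    rw [integral_mul_const] at h
    convert h using 5
    · rw [natCast_rpow_neg_half_sq]
      ring_nf
    · ring

end Main

theorem mainTheorem5
    {Ω : Type*} [MeasurableSpace Ω] (μ : Measure Ω) [IsProbabilityMeasure μ]
    (lam : ℝ) (hlam : 0 < lam)
    (β : ℝ) (hβ : 1 < β)
    (ψ : ℝ → ℝ) (ψ₁ : ℝ) (hψ₁ : 0 < ψ₁)
    (hψ_meas : AEMeasurable ψ (volume.restrict (Set.Ioo (0 : ℝ) 1)))
    (hψ_nonneg : ∀ x ∈ Set.Ioo (0 : ℝ) 1, 0 ≤ ψ x)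
    (hψ_lim : Tendsto ψ (𝓝[<] (1 : ℝ)) (𝓝 ψ₁))
    (α : ℕ → Ω → ℝ) (Y : ℕ → NoiseIndex → Ω → ℕ)
    (hα_law : ∀ j, μ.map (α j) =
      (volume.restrict (Set.Ioo (0 : ℝ) 1)).withDensity
        (fun x => ENNReal.ofReal (ψ x * (1 - x) ^ β)))
    (hY : ∀ j, IsRandomizedINARNoise μ lam (α j) (Y j))
    (h_indep : iIndepFun (fun j ω => ((α j ω, fun i => Y j i ω) : ℝ × (NoiseIndex → ℕ))) μ)
    {Ω' : Type*} [MeasurableSpace Ω'] (ν : Measure Ω') [IsProbabilityMeasure ν]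
    (B : ℝ≥0 → Ω' → ℝ) (hB : IsBrownianReal B ν)
    (σ : ℝ) (hσ : σ = √(lam * ∫ ω, (1 + α 0 ω) / (1 - α 0 ω) ^ 2 ∂μ)) :
    Integrable (fun ω => (1 + α 0 ω) / (1 - α 0 ω) ^ 2) μ ∧
    IsIteratedFDDLimit
      (fun n N t ω => ((n : ℝ) * (N : ℝ)) ^ (-(1 / 2) : ℝ)
        * aggregated μ α (fun j => inarProcess (Y j)) N n t ω)
      (fun t ω => σ * B t ω) μ ν ∧
    IsIteratedFDDLimit
      (fun N n t ω => ((n : ℝ) * (N : ℝ)) ^ (-(1 / 2) : ℝ)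
        * aggregated μ α (fun j => inarProcess (Y j)) N n t ω)
      (fun t ω => σ * B t ω) μ ν := by
  have hα : ∀ j, Measurable (α j) := fun j => (hY j).measurable_param
  have hlaw : ∀ j, μ.map (α j) = μ.map (α 0) := fun j => by rw [hα_law, hα_law]
  have ha : ∀ j, ∀ᵐ ω ∂μ, α j ω ∈ Set.Ioo (0 : ℝ) 1 := by
    intro j
    refine ae_of_ae_map (hα j).aemeasurable ?_
    rw [hα_law j]
    exact (withDensity_absolutelyContinuous _ _).ae_le (ae_restrict_mem measurableSet_Ioo)
  have hint : ∀ j, Integrable (fun ω => 1 / (1 - α j ω) ^ 2) μ := by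
    intro j
    -- That the prescribed density has total mass 1 is inferred from its being the law of `α j`; the
    -- next estimate needs this finite mass.
    have := Measure.isProbabilityMeasure_map (μ := μ) (hα j).aemeasurable
    have h := lintegral_inv_sq_lt_top hβ hψ_meas hψ_lim (hα_law j)
    rw [lintegral_map (by fun_prop) (hα j)] at h
    have hαj := hα j
    refine ⟨(by fun_prop : Measurable fun ω => 1 / (1 - α j ω) ^ 2).aestronglyMeasurable, ?_⟩
    rwa [hasFiniteIntegral_iff_ofReal (ae_of_all _ fun ω => by positivity)]
  have hint' := integrable_one_add_div_sq (hα 0) (ha 0) (hint 0)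
  have hσ2 : σ ^ 2 = lam * ∫ ω, (1 + α 0 ω) / (1 - α 0 ω) ^ 2 ∂μ := by
    rw [hσ, Real.sq_sqrt]
    refine mul_nonneg hlam.le (integral_nonneg_of_ae ?_)
    filter_upwards [ha 0] with ω hω
    have := hω.1
    show 0 ≤ (1 + α 0 ω) / (1 - α 0 ω) ^ 2
    positivity
  exact ⟨hint',
    isIteratedFDDLimit_copies_horizon hlam hY h_indep hlaw ha hint hB.toIsPreBrownianReal hσ2,
    isIteratedFDDLimit_horizon_copies hlam hY h_indep hlaw ha hint hB.toIsPreBrownianReal hσ2⟩
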